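/- Let $k$ be a field. A \emph{dialgebra} is a $k$-space $D$ with two bilinear associative products $\vdash,\dashv$ such that $a\dashv(b\vdash c)=a\dashv(b\dashv c)$, $(a\dashv b)\vdash c=(a\vdash b)\vdash c$ and $a\vdash(b\dashv c)=(a\vdash b)\dashv c$. An element $e$ is a \emph{bar unit} if $e\vdash x=x\dashv e=x$ for all $x$. \textbf{Definitions.} For a well-ordered set $Y$, the free dialgebra $D(Y)$ has as basis the normal diwords $[u]=y_{-m}\cdots y_{-1}\dot y_0y_1\cdots y_n$ ($m,n\ge 0$, $y_i\in Y$) with center $y_0$; the products concatenate words, $[u]\vdash[v]$ keeping the center of $[v]$ and $[u]\dashv[v]$ the center of $[u]$. Order normal diwords by comparing $(n+m+1,\,m,\,y_{-m},\dots,y_n)$ lexicographically; let $[\bar f]$ be the leading diword of $f\neq 0$, $\deg f$ its length, and call $f$ monic if $[\bar f]$ has coefficient $1$. Call $f$ left (right) normed if every diword of $f$ has its center at its right (left) end. For $s\in D(Y)$, an $s$-diword $[asb]$ is $y_{-m}\vdash\cdots\vdash y_0\dashv\cdots\dashv y_n$ with one $y_j$ replaced by $s$; it is normal if $j=0$, or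 $j<0$ and $s$ is left normed, or $j>0$ and $s$ is right normed; a normal $s$-diword is a left (right) normed $s$-diword if $s$ and $[asb]$ are both left (right) normed. $[a[\bar s]b]$ denotes the diword obtained by replacing $s$ by $[\bar s]$; an $S$-diword is an $s$-diword with $s\in S$. A set $S\subseteq D(Y)$ of monic elements is a \emph{Gr\"obner--Shirshov basis} if for all $f,g\in S$: (1) if $f$ is not right normed and $y\in Y$, then $y\dashv f$ is a linear combination of right normed $S$-diwords $[asb]$ with $|[a[\bar s]b]|\le\deg(y\dashv f)$; if $f$ is not left normed and $y\in Y$, then $f\vdash y$ is a linear combination of left normed $S$-diwords $[asb]$ with $|[a[\bar s]b]|\le\deg(f\vdash y)$ (the empty combination when the product is $0$); (2) (inclusion) if $[w]=[\bar f]=[a[\bar g]b]$ with $[agb]$ normal, then $f-[agb]$ is a linear combination of normal $S$-diwords $[a's'b']$ with $[a'[\bar{s'}]b']<[w]$; (3) (intersection) if $[w]=[[\bar f]b]=[a[\bar g]]$ with $|\bar f|+|\bar g|>|w|$ and $[fb]$, $[ag]$ normal, then $[fb]-[ag]$ is a linear combination of the same kind; where in (2) (resp. (3)) the $S$-diwords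 used must moreover be right (left) normed whenever both $f$ and $[agb]$ (resp. both $[fb]$ and $[ag]$) are right (left) normed $S$-diwords. \textbf{Theorem.} Let $D$ be a dialgebra over $k$. (i) There are a dialgebra $E$ over $k$ with a bar unit and an injective dialgebra homomorphism $D\to E$. (ii) Let $A$ be the ideal of $D$ generated by all $a\dashv b-a\vdash b$. Then $D$ has a $k$-basis $X=\{x_i\}_{i\in I}$ with $I$ well ordered and a subset $I_0\subseteq I$ such that $X_0=\{x_i\}_{i\in I_0}$ is a $k$-basis of $A$. (iii) For every such $X$, $I_0$, order $X\cup\{e\}$ by the order of $I$ and $x_i<e$, and write $\{x_i\vdash x_j\}$, $\{x_i\dashv x_j\}$ for the products in $D$ expanded as linear combinations of $X$. Let $S_1\subseteq D(X\cup\{e\})$ consist of $$x_i\vdash x_j-\{x_i\vdash x_j\},\quad x_i\dashv x_j-\{x_i\dashv x_j\},\quad e\vdash y-y,\quad y\dashv e-y,\quad x_{i_0}\vdash e,\quad e\dashv x_{i_0}$$ for $i,j\in I$, $y\in X\cup\{e\}$, $i_0\in I_0$. Then $S_1$ is a Gr\"obner--Shirshov basis in $D(X\cup\{e\})$, the class of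 $e$ is a bar unit of the dialgebra $D(X\cup\{e\}|S_1)=D(X\cup\{e\})/\mathrm{Id}(S_1)$ (where $\mathrm{Id}(S_1)$ is the ideal generated by $S_1$), and the linear map $D\to D(X\cup\{e\}|S_1)$ sending each $x_i$ to its class is an injective dialgebra homomorphism. -/

import Mathlib

universe u v w

/-! ### Dialgebras -/

/-- A type with two binary operations, written `a ⊢ᵈ b` and `a ⊣ᵈ b`. -/
class DiMul (D : Type*) where
  /-- the product `a ⊢ b` -/
  vd : D → D → D
  /-- the product `a ⊣ b` -/
  dv : D → D → D

infixl:70 " ⊢ᵈ " => DiMul.vd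
infixl:70 " ⊣ᵈ " => DiMul.dv

/-- `D` is a dialgebra over the field `k`: both products are bilinear and associative, and the
three mixed laws hold. -/
class IsDialgebra (k : Type*) (D : Type*) [Field k] [AddCommGroup D] [Module k D] [DiMul D] :
    Prop where
  add_vd : ∀ a b c : D, (a + b) ⊢ᵈ c = a ⊢ᵈ c + b ⊢ᵈ c
  vd_add : ∀ a b c : D, a ⊢ᵈ (b + c) = a ⊢ᵈ b + a ⊢ᵈ c
  smul_vd : ∀ (t : k) (a b : D), (t • a) ⊢ᵈ b = t • (a ⊢ᵈ b)
  vd_smul : ∀ (t : k) (a b : D), a ⊢ᵈ (t • b) = t • (a ⊢ᵈ b)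
  add_dv : ∀ a b c : D, (a + b) ⊣ᵈ c = a ⊣ᵈ c + b ⊣ᵈ c
  dv_add : ∀ a b c : D, a ⊣ᵈ (b + c) = a ⊣ᵈ b + a ⊣ᵈ c
  smul_dv : ∀ (t : k) (a b : D), (t • a) ⊣ᵈ b = t • (a ⊣ᵈ b)
  dv_smul : ∀ (t : k) (a b : D), a ⊣ᵈ (t • b) = t • (a ⊣ᵈ b)
  vd_assoc : ∀ a b c : D, (a ⊢ᵈ b) ⊢ᵈ c = a ⊢ᵈ (b ⊢ᵈ c)
  dv_assoc : ∀ a b c : D, (a ⊣ᵈ b) ⊣ᵈ c = a ⊣ᵈ (b ⊣ᵈ c)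
  dv_vd : ∀ a b c : D, a ⊣ᵈ (b ⊢ᵈ c) = a ⊣ᵈ (b ⊣ᵈ c)
  vd_dv : ∀ a b c : D, (a ⊣ᵈ b) ⊢ᵈ c = (a ⊢ᵈ b) ⊢ᵈ c
  vd_dv_assoc : ∀ a b c : D, a ⊢ᵈ (b ⊣ᵈ c) = (a ⊢ᵈ b) ⊣ᵈ c

/-- A linear map respecting both products. -/
def IsDialgebraHom {k D E : Type*} [Field k] [AddCommGroup D] [Module k D] [DiMul D]
    [AddCommGroup E] [Module k E] [DiMul E] (φ : D →ₗ[k] E) : Prop :=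
  ∀ a b : D, φ (a ⊢ᵈ b) = φ a ⊢ᵈ φ b ∧ φ (a ⊣ᵈ b) = φ a ⊣ᵈ φ b

/-- `e` is a bar unit: `e ⊢ x = x ⊣ e = x` for all `x`. -/
def IsBarUnit {D : Type*} [DiMul D] (e : D) : Prop :=
  ∀ x : D, e ⊢ᵈ x = x ∧ x ⊣ᵈ e = x

/-- Two-sided ideals for both products. -/
def IsDiIdeal {k D : Type*} [Field k] [AddCommGroup D] [Module k D] [DiMul D]
    (J : Submodule k D) : Prop :=
  ∀ a : D, ∀ x ∈ J, a ⊢ᵈ x ∈ J ∧ x ⊢ᵈ a ∈ J ∧ a ⊣ᵈ x ∈ J ∧ x ⊣ᵈ a ∈ J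

/-- The ideal generated by a set. -/
def diIdeal (k : Type*) {D : Type*} [Field k] [AddCommGroup D] [Module k D] [DiMul D]
    (s : Set D) : Submodule k D :=
  sInf {J : Submodule k D | IsDiIdeal J ∧ s ⊆ J}

theorem isDiIdeal_diIdeal (k : Type*) {D : Type*} [Field k] [AddCommGroup D] [Module k D]
    [DiMul D] (s : Set D) : IsDiIdeal (diIdeal k s) := by
  intro a x hx
  simp only [diIdeal, Submodule.mem_sInf, Set.mem_ofPred_eq] at hx ⊢
  exact ⟨fun J hJ => (hJ.1 a x (hx J hJ)).1, fun J hJ => (hJ.1 a x (hx J hJ)).2.1,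
    fun J hJ => (hJ.1 a x (hx J hJ)).2.2.1, fun J hJ => (hJ.1 a x (hx J hJ)).2.2.2⟩

/-- The ideal generated by all `a ⊣ b - a ⊢ b`. -/
def diffIdeal (k D : Type*) [Field k] [AddCommGroup D] [Module k D] [DiMul D] :
    Submodule k D :=
  diIdeal k {z : D | ∃ a b : D, z = a ⊣ᵈ b - a ⊢ᵈ b}

/-! ### Quotient dialgebras -/

section Quotient

variable {k D : Type*} [Field k] [AddCommGroup D] [Module k D] [DiMul D] [IsDialgebra k D]

theorem diIdeal_vd_congr (s : Set D) {a a' b b' : D}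
    (ha : a - a' ∈ diIdeal k s) (hb : b - b' ∈ diIdeal k s) :
    a ⊢ᵈ b - a' ⊢ᵈ b' ∈ diIdeal k s := by
  have h1 := (isDiIdeal_diIdeal k s b _ ha).2.1
  have h2 := (isDiIdeal_diIdeal k s a' _ hb).1
  have e1 : a ⊢ᵈ b = (a - a') ⊢ᵈ b + a' ⊢ᵈ b := by
    rw [← IsDialgebra.add_vd k, sub_add_cancel]
  have e2 : a' ⊢ᵈ b = a' ⊢ᵈ (b - b') + a' ⊢ᵈ b' := by
    rw [← IsDialgebra.vd_add k, sub_add_cancel]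
  have e3 : a ⊢ᵈ b - a' ⊢ᵈ b' = (a - a') ⊢ᵈ b + a' ⊢ᵈ (b - b') := by
    rw [e1, e2]; abel
  rw [e3]
  exact add_mem h1 h2

theorem diIdeal_dv_congr (s : Set D) {a a' b b' : D}
    (ha : a - a' ∈ diIdeal k s) (hb : b - b' ∈ diIdeal k s) :
    a ⊣ᵈ b - a' ⊣ᵈ b' ∈ diIdeal k s := by
  have h1 := (isDiIdeal_diIdeal k s b _ ha).2.2.2
  have h2 := (isDiIdeal_diIdeal k s a' _ hb).2.2.1
  have e1 : a ⊣ᵈ b = (a - a') ⊣ᵈ b + a' ⊣ᵈ b := by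
    rw [← IsDialgebra.add_dv k, sub_add_cancel]
  have e2 : a' ⊣ᵈ b = a' ⊣ᵈ (b - b') + a' ⊣ᵈ b' := by
    rw [← IsDialgebra.dv_add k, sub_add_cancel]
  have e3 : a ⊣ᵈ b - a' ⊣ᵈ b' = (a - a') ⊣ᵈ b + a' ⊣ᵈ (b - b') := by
    rw [e1, e2]; abel
  rw [e3]
  exact add_mem h1 h2

/-- The products of the quotient `D / Id(s)`, defined on representatives. -/
instance instDiMulQuotient (s : Set D) : DiMul (D ⧸ diIdeal k s) where
  vd := Quotient.map₂ (fun a b => a ⊢ᵈ b) (by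
    intro a a' ha b b' hb
    exact (Submodule.quotientRel_def _).2 (diIdeal_vd_congr s
      ((Submodule.quotientRel_def _).1 ha) ((Submodule.quotientRel_def _).1 hb)))
  dv := Quotient.map₂ (fun a b => a ⊣ᵈ b) (by
    intro a a' ha b b' hb
    exact (Submodule.quotientRel_def _).2 (diIdeal_dv_congr s
      ((Submodule.quotientRel_def _).1 ha) ((Submodule.quotientRel_def _).1 hb)))

theorem mkQ_vd (s : Set D) (a b : D) :
    (diIdeal k s).mkQ (a ⊢ᵈ b) = (diIdeal k s).mkQ a ⊢ᵈ (diIdeal k s).mkQ b := rfl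

theorem mkQ_dv (s : Set D) (a b : D) :
    (diIdeal k s).mkQ (a ⊣ᵈ b) = (diIdeal k s).mkQ a ⊣ᵈ (diIdeal k s).mkQ b := rfl

instance instIsDialgebraQuotient (s : Set D) : IsDialgebra k (D ⧸ diIdeal k s) := by
  have hs : ∀ q : D ⧸ diIdeal k s, ∃ a, (diIdeal k s).mkQ a = q :=
    Submodule.mkQ_surjective _
  constructor
  case smul_vd | vd_smul | smul_dv | dv_smul =>
    intro t p q
    obtain ⟨a, rfl⟩ := hs p
    obtain ⟨b, rfl⟩ := hs q
    simp only [← mkQ_vd, ← mkQ_dv, ← map_smul, IsDialgebra.smul_vd, IsDialgebra.vd_smul,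
      IsDialgebra.smul_dv, IsDialgebra.dv_smul]
  all_goals
    intro p q r
    obtain ⟨a, rfl⟩ := hs p
    obtain ⟨b, rfl⟩ := hs q
    obtain ⟨c, rfl⟩ := hs r
    simp only [← mkQ_vd, ← mkQ_dv, ← map_add]
    first
    | exact congrArg _ (IsDialgebra.add_vd k a b c)
    | exact congrArg _ (IsDialgebra.vd_add k a b c)
    | exact congrArg _ (IsDialgebra.add_dv k a b c)
    | exact congrArg _ (IsDialgebra.dv_add k a b c)
    | exact congrArg _ (IsDialgebra.vd_assoc k a b c)
    | exact congrArg _ (IsDialgebra.dv_assoc k a b c)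
    | exact congrArg _ (IsDialgebra.dv_vd k a b c)
    | exact congrArg _ (IsDialgebra.vd_dv k a b c)
    | exact congrArg _ (IsDialgebra.vd_dv_assoc k a b c)

end Quotient

/-! ### Normal diwords and the free dialgebra -/

/-- The normal diword `x₋ₘ ⋯ x₋₁ ẋ₀ x₁ ⋯ xₙ`: `left = [x₋ₘ, …, x₋₁]`, `center = x₀`,
`right = [x₁, …, xₙ]`. -/
@[ext]
structure Diword (X : Type*) where
  left : List X
  center : X
  right : List X

namespace Diword

variable {X : Type*}

/-- The underlying associative word. -/
def word (u : Diword X) : List X := u.left ++ u.center :: u.right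

/-- The length `n + m + 1`. -/
def length (u : Diword X) : ℕ := u.word.length

/-- Products of normal diwords: concatenate the words; `u ⊢ v` keeps the center of `v`, and
`u ⊣ v` keeps the center of `u`. -/
instance instDiMul : DiMul (Diword X) where
  vd u v := ⟨u.word ++ v.left, v.center, v.right⟩
  dv u v := ⟨u.left, u.center, u.right ++ v.word⟩

/-- The deg-lex ordering: compare `(n + m + 1, m, x₋ₘ, …, xₙ)` lexicographically. -/
instance instLT [LT X] : LT (Diword X) where
  lt u v := u.length < v.length ∨ (u.length = v.length ∧
    (u.left.length < v.left.length ∨ (u.left.length = v.left.length ∧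
      List.Lex (· < ·) u.word v.word)))

end Diword

/-- The free dialgebra `D(X)` over `k`: the vector space with basis the normal diwords. -/
abbrev FreeDi (k X : Type*) [Field k] : Type _ := Diword X →₀ k

namespace FreeDi

variable {k X : Type*} [Field k]

/-- The products of `D(X)`, extended bilinearly from normal diwords. -/
noncomputable instance instDiMul : DiMul (FreeDi k X) where
  vd f g := f.sum fun u a => g.sum fun v b => Finsupp.single (u ⊢ᵈ v) (a * b)
  dv f g := f.sum fun u a => g.sum fun v b => Finsupp.single (u ⊣ᵈ v) (a * b)

/-- The generator of `D(X)` given by a letter. -/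
noncomputable def gen (k : Type*) {X : Type*} [Field k] (y : X) : FreeDi k X :=
  Finsupp.single ⟨[], y, []⟩ 1

theorem vd_def (f g : FreeDi k X) : f ⊢ᵈ g =
    f.sum fun u a => g.sum fun v b => Finsupp.single (u ⊢ᵈ v) (a * b) := rfl

theorem dv_def (f g : FreeDi k X) : f ⊣ᵈ g =
    f.sum fun u a => g.sum fun v b => Finsupp.single (u ⊣ᵈ v) (a * b) := rfl

theorem single_vd_single (u v : Diword X) (a b : k) :
    (Finsupp.single u a : FreeDi k X) ⊢ᵈ Finsupp.single v b
      = Finsupp.single (u ⊢ᵈ v) (a * b) := by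
  rw [vd_def, Finsupp.sum_single_index (by simp), Finsupp.sum_single_index (by simp)]

theorem single_dv_single (u v : Diword X) (a b : k) :
    (Finsupp.single u a : FreeDi k X) ⊣ᵈ Finsupp.single v b
      = Finsupp.single (u ⊣ᵈ v) (a * b) := by
  rw [dv_def, Finsupp.sum_single_index (by simp), Finsupp.sum_single_index (by simp)]

theorem add_vd (f g h : FreeDi k X) : (f + g) ⊢ᵈ h = f ⊢ᵈ h + g ⊢ᵈ h := by
  classical
  simp only [vd_def]
  exact Finsupp.sum_add_index' (by simp) (by
    intro u a b; simp [add_mul, Finsupp.sum_add])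

theorem add_dv (f g h : FreeDi k X) : (f + g) ⊣ᵈ h = f ⊣ᵈ h + g ⊣ᵈ h := by
  classical
  simp only [dv_def]
  exact Finsupp.sum_add_index' (by simp) (by
    intro u a b; simp [add_mul, Finsupp.sum_add])

theorem vd_add (f g h : FreeDi k X) : f ⊢ᵈ (g + h) = f ⊢ᵈ g + f ⊢ᵈ h := by
  classical
  simp only [vd_def]
  rw [← Finsupp.sum_add]
  congr 1
  funext u a
  exact Finsupp.sum_add_index' (by simp) (by intro v b c; simp [mul_add])

theorem dv_add (f g h : FreeDi k X) : f ⊣ᵈ (g + h) = f ⊣ᵈ g + f ⊣ᵈ h := by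
  classical
  simp only [dv_def]
  rw [← Finsupp.sum_add]
  congr 1
  funext u a
  exact Finsupp.sum_add_index' (by simp) (by intro v b c; simp [mul_add])

theorem zero_vd (f : FreeDi k X) : (0 : FreeDi k X) ⊢ᵈ f = 0 := by simp [vd_def]
theorem zero_dv (f : FreeDi k X) : (0 : FreeDi k X) ⊣ᵈ f = 0 := by simp [dv_def]
theorem vd_zero (f : FreeDi k X) : f ⊢ᵈ (0 : FreeDi k X) = 0 := by simp [vd_def]
theorem dv_zero (f : FreeDi k X) : f ⊣ᵈ (0 : FreeDi k X) = 0 := by simp [dv_def]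

instance instIsDialgebra : IsDialgebra k (FreeDi k X) := by
  constructor
  case add_vd => exact add_vd
  case vd_add => exact vd_add
  case add_dv => exact add_dv
  case dv_add => exact dv_add
  case smul_vd | vd_smul | smul_dv | dv_smul =>
    intro t f g
    induction f using Finsupp.induction_linear with
    | zero => simp [zero_vd, zero_dv]
    | add f f' hf hf' => simp only [add_vd, add_dv, smul_add, hf, hf']
    | single u a =>
      induction g using Finsupp.induction_linear with
      | zero => simp [vd_zero, dv_zero]
      | add g g' hg hg' => simp only [vd_add, dv_add, smul_add, hg, hg']
      | single v b =>
        simp only [Finsupp.smul_single, single_vd_single, single_dv_single, smul_eq_mul]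
        congr 1
        ring
  all_goals
    intro f g h
    induction f using Finsupp.induction_linear with
    | zero => simp [zero_vd, zero_dv]
    | add f f' hf hf' => simp only [add_vd, add_dv, hf, hf']
    | single u a =>
      induction g using Finsupp.induction_linear with
      | zero => simp [zero_vd, zero_dv, vd_zero, dv_zero]
      | add g g' hg hg' => simp only [add_vd, add_dv, vd_add, dv_add, hg, hg']
      | single v b =>
        induction h using Finsupp.induction_linear with
        | zero => simp [vd_zero, dv_zero]
        | add h h' hh hh' => simp only [vd_add, dv_add, hh, hh']
        | single w c =>
          simp only [single_vd_single, single_dv_single, mul_assoc]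
          congr 1 <;> simp [DiMul.vd, DiMul.dv, Diword.word]

/-! ### Leading diwords, normed polynomials -/

/-- `u` is the leading diword of `f` (so `f ≠ 0`). -/
def IsLeading [LT X] (f : FreeDi k X) (u : Diword X) : Prop :=
  u ∈ f.support ∧ ∀ v ∈ f.support, v ≠ u → v < u

/-- The leading coefficient is `1`. -/
def IsMonic [LT X] (f : FreeDi k X) : Prop :=
  ∃ u, IsLeading f u ∧ f u = 1

/-- All diwords of `f` have their center at the right end. -/
def LeftNormed (f : FreeDi k X) : Prop := ∀ u ∈ f.support, u.right = []

/-- All diwords of `f` have their center at the left end. -/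
def RightNormed (f : FreeDi k X) : Prop := ∀ u ∈ f.support, u.left = []

/-- The degree: the length of the leading diword, i.e. the largest length of a diword of `f`
(and `0` for `f = 0`). -/
noncomputable def deg (f : FreeDi k X) : ℕ := f.support.sup Diword.length

end FreeDi

/-! ### `S`-diwords -/

/-- The normal form `x₋ₘ ⊢ ⋯ ⊢ x₀ ⊣ ⋯ ⊣ xₙ` with the letter `x_j` replaced by a hole:
* `mid a b`: the hole is at the center, `[a ◻̇ b]` (`j = 0`);
* `lft a b₁ c b₂`: the hole is left of the center, `[a ◻ b₁ ċ b₂]` (`j < 0`);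
* `rgt a₁ c a₂ b`: the hole is right of the center, `[a₁ ċ a₂ ◻ b]` (`j > 0`). -/
inductive DiCtx (X : Type*) where
  | mid (a b : List X) : DiCtx X
  | lft (a b₁ : List X) (c : X) (b₂ : List X) : DiCtx X
  | rgt (a₁ : List X) (c : X) (a₂ b : List X) : DiCtx X

namespace DiCtx

variable {k X : Type*} [Field k]

/-- The word before the hole. -/
def pre : DiCtx X → List X
  | mid a _ => a
  | lft a _ _ _ => a
  | rgt a₁ c a₂ _ => a₁ ++ c :: a₂

/-- The word after the hole. -/
def post : DiCtx X → List X
  | mid _ b => b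
  | lft _ b₁ c b₂ => b₁ ++ c :: b₂
  | rgt _ _ _ b => b

/-- The normal diword obtained by putting a normal diword into the hole. -/
def fill : DiCtx X → Diword X → Diword X
  | mid a b, u => ⟨a ++ u.left, u.center, u.right ++ b⟩
  | lft a b₁ c b₂, u => ⟨a ++ u.word ++ b₁, c, b₂⟩
  | rgt a₁ c a₂ b, u => ⟨a₁, c, a₂ ++ u.word ++ b⟩

/-- The `s`-diword `[asb]`: the element `s` of `D(X)` is put into the hole (`fill`, extended
linearly). -/
noncomputable def app (C : DiCtx X) (s : FreeDi k X) : FreeDi k X :=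
  Finsupp.mapDomain C.fill s

/-- `x₁ ⊢ ⋯ ⊢ xₙ ⊢ f` -/
noncomputable def vdWord (a : List X) (f : FreeDi k X) : FreeDi k X :=
  a.foldr (fun x g => FreeDi.gen k x ⊢ᵈ g) f

/-- `f ⊣ x₁ ⊣ ⋯ ⊣ xₙ` -/
noncomputable def dvWord (f : FreeDi k X) (b : List X) : FreeDi k X :=
  b.foldl (fun g x => g ⊣ᵈ FreeDi.gen k x) f

theorem gen_vd (x : X) (f : FreeDi k X) : FreeDi.gen k x ⊢ᵈ f =
    Finsupp.mapDomain (fun u => (⟨x :: u.left, u.center, u.right⟩ : Diword X)) f := by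
  induction f using Finsupp.induction_linear with
  | zero => simp [FreeDi.vd_zero]
  | add f g hf hg => rw [FreeDi.vd_add, hf, hg, Finsupp.mapDomain_add]
  | single u a =>
    rw [FreeDi.gen, FreeDi.single_vd_single, Finsupp.mapDomain_single, one_mul]
    rfl

theorem dv_gen (x : X) (f : FreeDi k X) : f ⊣ᵈ FreeDi.gen k x =
    Finsupp.mapDomain (fun u => (⟨u.left, u.center, u.right ++ [x]⟩ : Diword X)) f := by
  induction f using Finsupp.induction_linear with
  | zero => simp [FreeDi.zero_dv]
  | add f g hf hg => rw [FreeDi.add_dv, hf, hg, Finsupp.mapDomain_add]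
  | single u a =>
    rw [FreeDi.gen, FreeDi.single_dv_single, Finsupp.mapDomain_single, mul_one]
    rfl

theorem vdWord_eq (a : List X) (f : FreeDi k X) : vdWord a f =
    Finsupp.mapDomain (fun u => (⟨a ++ u.left, u.center, u.right⟩ : Diword X)) f := by
  induction a with
  | nil => exact (Finsupp.mapDomain_id (v := f)).symm
  | cons x a ih =>
    change FreeDi.gen k x ⊢ᵈ vdWord a f = _
    rw [ih, gen_vd, ← Finsupp.mapDomain_comp]
    rfl

theorem dvWord_eq (b : List X) (f : FreeDi k X) : dvWord f b =
    Finsupp.mapDomain (fun u => (⟨u.left, u.center, u.right ++ b⟩ : Diword X)) f := by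
  induction b generalizing f with
  | nil =>
    simp only [List.append_nil]
    exact (Finsupp.mapDomain_id (v := f)).symm
  | cons x b ih =>
    change dvWord (f ⊣ᵈ FreeDi.gen k x) b = _
    rw [ih, dv_gen, ← Finsupp.mapDomain_comp]
    congr 1
    funext u
    simp

/-- `app` at the center is `a ⊢ s ⊣ b`. -/
theorem app_mid (a b : List X) (s : FreeDi k X) :
    app (mid a b) s = dvWord (vdWord a s) b := by
  rw [vdWord_eq, dvWord_eq, ← Finsupp.mapDomain_comp]
  rfl

/-- `app` left of the center is `a ⊢ s ⊢ b₁ ⊢ c ⊣ b₂`. -/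
theorem app_lft (a b₁ : List X) (c : X) (b₂ : List X) (s : FreeDi k X) :
    app (lft a b₁ c b₂) s =
      dvWord (vdWord a (s ⊢ᵈ vdWord b₁ (FreeDi.gen k c))) b₂ := by
  rw [vdWord_eq, dvWord_eq, ← Finsupp.mapDomain_comp, vdWord_eq]
  induction s using Finsupp.induction_linear with
  | zero => simp [app, FreeDi.zero_vd]
  | add f g hf hg =>
    rw [FreeDi.add_vd, Finsupp.mapDomain_add, ← hf, ← hg]
    exact Finsupp.mapDomain_add
  | single u t =>
    rw [FreeDi.gen, Finsupp.mapDomain_single, FreeDi.single_vd_single, Finsupp.mapDomain_single,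
      app, Finsupp.mapDomain_single]
    congr 1
    · simp [fill, DiMul.vd]
    · simp

/-- `app` right of the center is `a₁ ⊢ c ⊣ a₂ ⊣ s ⊣ b`. -/
theorem app_rgt (a₁ : List X) (c : X) (a₂ b : List X) (s : FreeDi k X) :
    app (rgt a₁ c a₂ b) s =
      dvWord (dvWord (vdWord a₁ (FreeDi.gen k c)) a₂ ⊣ᵈ s) b := by
  rw [vdWord_eq, dvWord_eq, dvWord_eq, ← Finsupp.mapDomain_comp]
  induction s using Finsupp.induction_linear with
  | zero => simp [app, FreeDi.dv_zero]
  | add f g hf hg =>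
    rw [FreeDi.dv_add, Finsupp.mapDomain_add, ← hf, ← hg]
    exact Finsupp.mapDomain_add
  | single u t =>
    rw [FreeDi.gen, Finsupp.mapDomain_single, FreeDi.single_dv_single, Finsupp.mapDomain_single,
      app, Finsupp.mapDomain_single]
    congr 1
    · simp [fill, DiMul.dv]
    · simp

/-- The `s`-diword `[asb]` is normal. -/
def IsNormal (C : DiCtx X) (s : FreeDi k X) : Prop :=
  match C with
  | mid _ _ => True
  | lft _ _ _ _ => FreeDi.LeftNormed s
  | rgt _ _ _ _ => FreeDi.RightNormed s

/-- `[asb]` is a left normed `s`-diword. -/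
def IsLeftNormed (C : DiCtx X) (s : FreeDi k X) : Prop :=
  C.IsNormal s ∧ FreeDi.LeftNormed s ∧ FreeDi.LeftNormed (C.app s)

/-- `[asb]` is a right normed `s`-diword. -/
def IsRightNormed (C : DiCtx X) (s : FreeDi k X) : Prop :=
  C.IsNormal s ∧ FreeDi.RightNormed s ∧ FreeDi.RightNormed (C.app s)

end DiCtx

/-! ### Gröbner–Shirshov bases in `D(X)` -/

namespace FreeDi

variable {k X : Type*} [Field k] [LT X]

/-- A composition `h = x ⊣ f` of left multiplication is trivial modulo `S`. -/
def TrivialLeft (S : Set (FreeDi k X)) (h : FreeDi k X) : Prop :=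
  h ∈ Submodule.span k {p : FreeDi k X | ∃ s ∈ S, ∃ (C : DiCtx X) (u : Diword X),
    IsLeading s u ∧ C.IsRightNormed s ∧ (C.fill u).length ≤ deg h ∧ p = C.app s}

/-- A composition `h = f ⊢ x` of right multiplication is trivial modulo `S`. -/
def TrivialRight (S : Set (FreeDi k X)) (h : FreeDi k X) : Prop :=
  h ∈ Submodule.span k {p : FreeDi k X | ∃ s ∈ S, ∃ (C : DiCtx X) (u : Diword X),
    IsLeading s u ∧ C.IsLeftNormed s ∧ (C.fill u).length ≤ deg h ∧ p = C.app s}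

/-- The composition `[C₁ f] - [C₂ g]` with ambiguity `w` is trivial modulo `(S, w)`: it is a linear
combination of normal `S`-diwords with leading diword `< w`, which are right (left) normed
whenever both `[C₁ f]` and `[C₂ g]` are. -/
def TrivialAt (S : Set (FreeDi k X)) (w : Diword X) (C₁ : DiCtx X) (f : FreeDi k X)
    (C₂ : DiCtx X) (g : FreeDi k X) : Prop :=
  C₁.app f - C₂.app g ∈ Submodule.span k {p : FreeDi k X |
    ∃ s ∈ S, ∃ (C : DiCtx X) (u : Diword X),
      IsLeading s u ∧ C.IsNormal s ∧ C.fill u < w ∧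
      (C₁.IsRightNormed f ∧ C₂.IsRightNormed g → C.IsRightNormed s) ∧
      (C₁.IsLeftNormed f ∧ C₂.IsLeftNormed g → C.IsLeftNormed s) ∧
      p = C.app s}

/-- `S` is a Gröbner–Shirshov basis in `D(X)`: `S` is a set of monic polynomials all of whose
compositions (of left and right multiplication, of inclusion, of intersection) are trivial. -/
structure IsGSBasis (S : Set (FreeDi k X)) : Prop where
  monic : ∀ s ∈ S, IsMonic s
  left_mul : ∀ f ∈ S, ¬ RightNormed f → ∀ x : X, TrivialLeft S (gen k x ⊣ᵈ f)
  right_mul : ∀ f ∈ S, ¬ LeftNormed f → ∀ x : X, TrivialRight S (f ⊢ᵈ gen k x)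
  inclusion : ∀ f ∈ S, ∀ g ∈ S, ∀ (u v : Diword X), IsLeading f u → IsLeading g v →
    ∀ C : DiCtx X, C.IsNormal g → C.fill v = u →
      TrivialAt S u (DiCtx.mid [] []) f C g
  intersection : ∀ f ∈ S, ∀ g ∈ S, ∀ (u v w : Diword X), IsLeading f u → IsLeading g v →
    ∀ C₁ C₂ : DiCtx X, C₁.pre = [] → C₂.post = [] → C₁.IsNormal f → C₂.IsNormal g →
      C₁.fill u = w → C₂.fill v = w → w.length < u.length + v.length →
      TrivialAt S w C₁ f C₂ g

end FreeDi

/-! ### The bar extension -/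

section BarExtension

variable {k D I : Type*} [Field k] [AddCommGroup D] [Module k D] [DiMul D]

/-- The linear map `D → D(X ∪ {e})` sending the basis element `x i` to the letter `x_i`. The
alphabet `X ∪ {e}` is `WithTop I`, with `e = ⊤`, so that `x_i < e` for all `i`. -/
noncomputable def barLift (x : Module.Basis I k D) : D →ₗ[k] FreeDi k (WithTop I) :=
  x.constr k fun i => FreeDi.gen k (i : WithTop I)

/-- The relations `S₁`: the multiplication table of `D` in the basis `x`, together with
`e ⊢ y - y`, `y ⊣ e - y`, `x₀ ⊢ e` and `e ⊣ x₀`, for letters `y ∈ X ∪ {e}` and `x₀ ∈ X₀`. -/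
def barRel (x : Module.Basis I k D) (I₀ : Set I) : Set (FreeDi k (WithTop I)) :=
  {p | ∃ i j : I, p = FreeDi.gen k (i : WithTop I) ⊢ᵈ FreeDi.gen k (j : WithTop I)
      - barLift x (x i ⊢ᵈ x j)} ∪
  {p | ∃ i j : I, p = FreeDi.gen k (i : WithTop I) ⊣ᵈ FreeDi.gen k (j : WithTop I)
      - barLift x (x i ⊣ᵈ x j)} ∪
  {p | ∃ y : WithTop I, p = FreeDi.gen k (⊤ : WithTop I) ⊢ᵈ FreeDi.gen k y - FreeDi.gen k y} ∪
  {p | ∃ y : WithTop I, p = FreeDi.gen k y ⊣ᵈ FreeDi.gen k (⊤ : WithTop I) - FreeDi.gen k y} ∪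
  {p | ∃ i ∈ I₀, p = FreeDi.gen k (i : WithTop I) ⊢ᵈ FreeDi.gen k (⊤ : WithTop I)} ∪
  {p | ∃ i ∈ I₀, p = FreeDi.gen k (⊤ : WithTop I) ⊣ᵈ FreeDi.gen k (i : WithTop I)}

/-- The dialgebra `D₁ = D(X ∪ {e} | S₁) = D(X ∪ {e}) / Id(S₁)`. -/
abbrev BarExt (x : Module.Basis I k D) (I₀ : Set I) : Type _ :=
  FreeDi k (WithTop I) ⧸ diIdeal k (barRel x I₀)

end BarExtension

/-! Every `a` in the ideal `A` satisfies `a ⊢ y = 0` and `y ⊣ a = 0` for all `y`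
(`annihilates_of_mem_diffIdeal`): the mixed laws say this for the generators, and such elements form
an ideal. Hence `D / A`, where the two products coincide, is an associative algebra acting on `D` on
the left through `⊢` and on the right through `⊣`.

Let `B` be the unitization of `D / A`. The space `D ⊕ B` is a `B`-bimodule, and `π(d, b) = [d] + b`
is a bimodule map to `B`. Any such map makes the bimodule a dialgebra by `m ⊢ n = π(m) n` and `m ⊣ n
= m π(n)`. This is `BarHull`: it contains `D`, and `(0, 1)` is a bar unit because `π` sends it to
`1`. This gives the first claim.

The hull also proves injectivity into the presented dialgebra without a normal form argument. For
`a` in `A` one has `π(a) = 0`, so `a ⊢ e = 0 = e ⊣ a` in the hull. All relations `S₁` therefore hold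
there (`diIdeal_barRel_le_ker`), and the embedding of `D` into the hull factors through the
quotient.

The Gröbner–Shirshov property is a separate finite check. Each relation is a word of length two
minus a combination of letters, and its leading diword determines it. Inclusions are thus trivial,
and proper overlaps have length three. There, associativity in `D`, the unit relations and the
annihilation property reduce each composition to a combination of relations themselves
(`VdRel.overlap_mem`, `DvRel.overlap_mem`, `VdRel.overlap_dvRel_mem`). Multiplication on the
forgetful side exchanges `⊢` and `⊣` inside a relation; the resulting error comes from `A` and is
annihilated (`VdRel.trivialLeft`, `DvRel.trivialRight`). -/

/-! ### General facts on dialgebras -/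

section General

variable {k D : Type*} [Field k] [AddCommGroup D] [Module k D] [DiMul D] [IsDialgebra k D]

variable (k D) in
/-- The product `⊢` as a bilinear map. -/
def vdMap : D →ₗ[k] D →ₗ[k] D :=
  LinearMap.mk₂ k (fun a b => a ⊢ᵈ b) (IsDialgebra.add_vd k) IsDialgebra.smul_vd
    (IsDialgebra.vd_add k) IsDialgebra.vd_smul

variable (k D) in
/-- The product `⊣` as a bilinear map. -/
def dvMap : D →ₗ[k] D →ₗ[k] D :=
  LinearMap.mk₂ k (fun a b => a ⊣ᵈ b) (IsDialgebra.add_dv k) IsDialgebra.smul_dv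
    (IsDialgebra.dv_add k) IsDialgebra.dv_smul

theorem vdMap_apply (a b : D) : vdMap k D a b = a ⊢ᵈ b := rfl

theorem dvMap_apply (a b : D) : dvMap k D a b = a ⊣ᵈ b := rfl

theorem vd_sub_right (k : Type*) {D : Type*} [Field k] [AddCommGroup D] [Module k D] [DiMul D]
    [IsDialgebra k D] (a b c : D) : a ⊢ᵈ (b - c) = a ⊢ᵈ b - a ⊢ᵈ c := map_sub (vdMap k D a) b c

theorem dv_sub_right (k : Type*) {D : Type*} [Field k] [AddCommGroup D] [Module k D] [DiMul D]
    [IsDialgebra k D] (a b c : D) : a ⊣ᵈ (b - c) = a ⊣ᵈ b - a ⊣ᵈ c := map_sub (dvMap k D a) b c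

theorem vd_sub_left (k : Type*) {D : Type*} [Field k] [AddCommGroup D] [Module k D] [DiMul D]
    [IsDialgebra k D] (a b c : D) : (a - b) ⊢ᵈ c = a ⊢ᵈ c - b ⊢ᵈ c :=
  LinearMap.map_sub₂ (vdMap k D) a b c

theorem dv_sub_left (k : Type*) {D : Type*} [Field k] [AddCommGroup D] [Module k D] [DiMul D]
    [IsDialgebra k D] (a b c : D) : (a - b) ⊣ᵈ c = a ⊣ᵈ c - b ⊣ᵈ c :=
  LinearMap.map_sub₂ (dvMap k D) a b c

theorem vd_zero_right (k : Type*) {D : Type*} [Field k] [AddCommGroup D] [Module k D] [DiMul D]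
    [IsDialgebra k D] (a : D) : a ⊢ᵈ (0 : D) = 0 := map_zero (vdMap k D a)

theorem dv_zero_right (k : Type*) {D : Type*} [Field k] [AddCommGroup D] [Module k D] [DiMul D]
    [IsDialgebra k D] (a : D) : a ⊣ᵈ (0 : D) = 0 := map_zero (dvMap k D a)

theorem vd_zero_left (k : Type*) {D : Type*} [Field k] [AddCommGroup D] [Module k D] [DiMul D]
    [IsDialgebra k D] (a : D) : (0 : D) ⊢ᵈ a = 0 := LinearMap.map_zero₂ (vdMap k D) a

theorem dv_zero_left (k : Type*) {D : Type*} [Field k] [AddCommGroup D] [Module k D] [DiMul D]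
    [IsDialgebra k D] (a : D) : (0 : D) ⊣ᵈ a = 0 := LinearMap.map_zero₂ (dvMap k D) a

theorem subset_diIdeal {k D : Type*} [Field k] [AddCommGroup D] [Module k D] [DiMul D]
    (s : Set D) : s ⊆ diIdeal k s := fun a ha => by
  simp only [diIdeal, SetLike.mem_coe, Submodule.mem_sInf]
  exact fun J hJ => hJ.2 ha

theorem diIdeal_le {k D : Type*} [Field k] [AddCommGroup D] [Module k D] [DiMul D]
    {s : Set D} {J : Submodule k D} (hJ : IsDiIdeal J) (hs : s ⊆ J) :
    diIdeal k s ≤ J := sInf_le ⟨hJ, hs⟩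

/-- The ideal generated by all `a ⊣ b - a ⊢ b` annihilates `D` through both products. -/
theorem annihilates_of_mem_diffIdeal {a : D} (ha : a ∈ diffIdeal k D) (y : D) :
    a ⊢ᵈ y = 0 ∧ y ⊣ᵈ a = 0 := by
  -- The common annihilator for the two products. It is an ideal, and the mixed laws put the
  -- generators of `A` into it.
  let J : Submodule k D := LinearMap.ker (vdMap k D) ⊓ LinearMap.ker (dvMap k D).flip
  have mem : ∀ z, z ∈ J ↔ (∀ y, z ⊢ᵈ y = 0) ∧ ∀ y, y ⊣ᵈ z = 0 := fun z => by
    simp only [J, Submodule.mem_inf, LinearMap.mem_ker, LinearMap.ext_iff, LinearMap.flip_apply,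
      vdMap_apply, dvMap_apply, LinearMap.zero_apply]
  have hJ : diffIdeal k D ≤ J := by
    apply diIdeal_le
    · intro c z hz
      rw [mem] at hz
      simp only [mem]
      refine ⟨⟨fun y => ?_, fun y => ?_⟩, ⟨fun y => ?_, fun y => ?_⟩, ⟨fun y => ?_, fun y => ?_⟩,
        ⟨fun y => ?_, fun y => ?_⟩⟩
      · rw [IsDialgebra.vd_assoc k, hz.1, vd_zero_right k]
      · rw [IsDialgebra.dv_vd k, ← IsDialgebra.dv_assoc k, hz.2]
      · rw [IsDialgebra.vd_assoc k, hz.1]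
      · rw [IsDialgebra.dv_vd k, ← IsDialgebra.dv_assoc k, hz.2, dv_zero_left k]
      · rw [IsDialgebra.vd_dv k, IsDialgebra.vd_assoc k, hz.1, vd_zero_right k]
      · rw [← IsDialgebra.dv_assoc k, hz.2]
      · rw [IsDialgebra.vd_dv k, IsDialgebra.vd_assoc k, hz.1]
      · rw [← IsDialgebra.dv_assoc k, hz.2, dv_zero_left k]
    · rintro _ ⟨c, d, rfl⟩
      rw [SetLike.mem_coe, mem]
      refine ⟨fun y => ?_, fun y => ?_⟩
      · rw [vd_sub_left k, IsDialgebra.vd_dv k, sub_self]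
      · rw [dv_sub_right k, IsDialgebra.dv_vd k, sub_self]
  exact ⟨((mem a).1 (hJ ha)).1 y, ((mem a).1 (hJ ha)).2 y⟩

theorem isDiIdeal_diffIdeal (k D : Type*) [Field k] [AddCommGroup D] [Module k D] [DiMul D] :
    IsDiIdeal (diffIdeal k D) := isDiIdeal_diIdeal k _

theorem dv_sub_vd_mem_diffIdeal {k D : Type*} [Field k] [AddCommGroup D] [Module k D] [DiMul D]
    (a b : D) : a ⊣ᵈ b - a ⊢ᵈ b ∈ diffIdeal k D :=
  subset_diIdeal _ ⟨a, b, rfl⟩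

end General

/-! ### A bar unit extension by the unitization of `D / A` -/

section BarHull

variable (k D : Type*) [Field k] [AddCommGroup D] [Module k D] [DiMul D] [IsDialgebra k D]

/-- The quotient of `D` by the ideal `A` generated by all `a ⊣ b - a ⊢ b`, in which the two
products agree. -/
abbrev DiffQuotient : Type _ := D ⧸ diIdeal k {z : D | ∃ a b : D, z = a ⊣ᵈ b - a ⊢ᵈ b}

variable {k D}

theorem diffQuotient_dv_eq_vd (a b : DiffQuotient k D) : a ⊣ᵈ b = a ⊢ᵈ b := by
  obtain ⟨a, rfl⟩ := Submodule.mkQ_surjective _ a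
  obtain ⟨b, rfl⟩ := Submodule.mkQ_surjective _ b
  rw [← mkQ_vd, ← mkQ_dv, ← sub_eq_zero, ← map_sub]
  exact (Submodule.Quotient.mk_eq_zero _).2 (dv_sub_vd_mem_diffIdeal a b)

variable (k D)

/-- The left action of `D / A` on `D` induced by `⊢`. -/
def leftAct : DiffQuotient k D →ₗ[k] D →ₗ[k] D :=
  Submodule.liftQ _ (vdMap k D) fun _ ha =>
    LinearMap.ext fun y => (annihilates_of_mem_diffIdeal ha y).1

/-- The right action of `D / A` on `D` induced by `⊣`. -/
def rightAct : DiffQuotient k D →ₗ[k] D →ₗ[k] D :=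
  Submodule.liftQ _ (dvMap k D).flip fun _ ha =>
    LinearMap.ext fun y => (annihilates_of_mem_diffIdeal ha y).2

/-- The direct sum of `D` and of the unitization of `D / A`. -/
def BarHull : Type _ := D × k × DiffQuotient k D

noncomputable instance : AddCommGroup (BarHull k D) :=
  inferInstanceAs (AddCommGroup (D × k × DiffQuotient k D))

noncomputable instance : Module k (BarHull k D) :=
  inferInstanceAs (Module k (D × k × DiffQuotient k D))

variable {k D}

namespace BarHull

/-- The element of the hull with the given components, the last one given by a representative. -/
def mk (d : D) (t : k) (c : D) : BarHull k D := (d, t, Submodule.Quotient.mk c)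

/-- The component in `D / A` of the image of an element in the unitization of `D / A`. -/
def proj (m : BarHull k D) : DiffQuotient k D := Submodule.Quotient.mk m.1 + m.2.2

/-- With `B` the unitization of `D / A` and `π(m) = m.2.1 + m.proj` in `B`, these are `π(m) n` and
`m π(n)`, expanded in coordinates for the bimodule `D ⊕ B`. -/
instance : DiMul (BarHull k D) where
  vd m n := (m.2.1 • n.1 + leftAct k D m.proj n.1, m.2.1 * n.2.1,
    m.2.1 • n.2.2 + n.2.1 • m.proj + m.proj ⊢ᵈ n.2.2)
  dv m n := (n.2.1 • m.1 + rightAct k D n.proj m.1, m.2.1 * n.2.1,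
    n.2.1 • m.2.2 + m.2.1 • n.proj + m.2.2 ⊢ᵈ n.proj)

omit [IsDialgebra k D] in
theorem exists_mk (m : BarHull k D) : ∃ d t c, m = mk d t c := by
  obtain ⟨d, t, c⟩ := m
  obtain ⟨c, rfl⟩ := Submodule.Quotient.mk_surjective _ c
  exact ⟨d, t, c, rfl⟩

theorem mk_vd_mk (d d' : D) (t t' : k) (c c' : D) : mk d t c ⊢ᵈ mk d' t' c' =
    mk (t • d' + (d + c) ⊢ᵈ d') (t * t') (t • c' + t' • (d + c) + (d + c) ⊢ᵈ c') := rfl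

theorem mk_dv_mk (d d' : D) (t t' : k) (c c' : D) : mk d t c ⊣ᵈ mk d' t' c' =
    mk (t' • d + d ⊣ᵈ (d' + c')) (t * t') (t' • c + t • (d' + c') + c ⊢ᵈ (d' + c')) := rfl

omit [IsDialgebra k D] in
theorem mk_add_mk (d d' : D) (t t' : k) (c c' : D) :
    mk d t c + mk d' t' c' = mk (d + d') (t + t') (c + c') := rfl

omit [IsDialgebra k D] in
theorem smul_mk (r : k) (d : D) (t : k) (c : D) :
    r • mk d t c = mk (r • d) (r * t) (r • c) := rfl

omit [IsDialgebra k D] in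
theorem mk_congr {d d' : D} {t t' : k} {c c' : D} (hd : d = d') (ht : t = t')
    (hc : (diIdeal k {z : D | ∃ a b : D, z = a ⊣ᵈ b - a ⊢ᵈ b}).mkQ c =
      (diIdeal k {z : D | ∃ a b : D, z = a ⊣ᵈ b - a ⊢ᵈ b}).mkQ c') :
    mk d t c = mk d' t' c' := by
  subst hd ht
  exact congrArg (fun q => ((d, t, q) : D × k × DiffQuotient k D)) hc

/-- The laws are the bimodule laws together with the compatibility of `m ↦ m.2.1 + m.proj` with the
actions. On representatives, the components in `D` and `k` agree exactly, while the last one agrees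
only modulo `A`. -/
instance : IsDialgebra k (BarHull k D) := by
  constructor
  case smul_vd | vd_smul | smul_dv | dv_smul =>
    intro r m n
    obtain ⟨d, t, c, rfl⟩ := m.exists_mk
    obtain ⟨d', t', c', rfl⟩ := n.exists_mk
    simp only [mk_vd_mk, mk_dv_mk, smul_mk]
    apply mk_congr
    · simp only [← smul_add, IsDialgebra.smul_vd, IsDialgebra.vd_smul,
        IsDialgebra.smul_dv, IsDialgebra.dv_smul]
      module
    · ring
    · congr 1
      simp only [← smul_add, IsDialgebra.smul_vd, IsDialgebra.vd_smul]
      module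
  all_goals
    intro m n o
    obtain ⟨d, t, c, rfl⟩ := m.exists_mk
    obtain ⟨d', t', c', rfl⟩ := n.exists_mk
    obtain ⟨d'', t'', c'', rfl⟩ := o.exists_mk
    simp only [mk_vd_mk, mk_dv_mk, mk_add_mk]
    apply mk_congr
    · simp only [IsDialgebra.add_vd k, IsDialgebra.vd_add k, IsDialgebra.add_dv k,
        IsDialgebra.dv_add k, IsDialgebra.smul_vd, IsDialgebra.vd_smul,
        IsDialgebra.smul_dv, IsDialgebra.dv_smul, IsDialgebra.dv_vd k, IsDialgebra.vd_dv k,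
        IsDialgebra.vd_assoc k, IsDialgebra.dv_assoc k, ← IsDialgebra.vd_dv_assoc k]
      module
    · ring
    -- In the quotient the two products are identified, which leaves an identity in an associative
    -- algebra.
    · simp only [map_add, map_smul, mkQ_vd, mkQ_dv, diffQuotient_dv_eq_vd,
        IsDialgebra.add_vd k, IsDialgebra.vd_add k, IsDialgebra.smul_vd, IsDialgebra.vd_smul,
        IsDialgebra.vd_assoc k]
      module

variable (k D)

/-- The inclusion of `D`. -/
noncomputable def incl : D →ₗ[k] BarHull k D := LinearMap.inl k D (k × DiffQuotient k D)

/-- The bar unit. -/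
def unit : BarHull k D := mk 0 1 0

variable {k D}

omit [IsDialgebra k D] in
theorem incl_eq (d : D) : incl k D d = mk d 0 0 := rfl

omit [IsDialgebra k D] in
theorem incl_injective : Function.Injective (incl k D) := LinearMap.inl_injective

theorem isDialgebraHom_incl : IsDialgebraHom (incl k D) := by
  intro a b
  simp only [incl_eq, mk_vd_mk, mk_dv_mk]
  constructor <;> apply mk_congr <;>
    simp [vd_zero_right k, vd_zero_left k]

theorem isBarUnit_unit : IsBarUnit (unit k D) := by
  intro m
  obtain ⟨d, t, c, rfl⟩ := m.exists_mk
  simp only [unit, mk_vd_mk, mk_dv_mk]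
  constructor <;> apply mk_congr <;>
    simp [vd_zero_left k, vd_zero_right k, dv_zero_right k]

/-- Only the class of `a` in `D / A` survives in this product, so it vanishes on `A`. -/
theorem incl_vd_unit {a : D} (ha : a ∈ diffIdeal k D) : incl k D a ⊢ᵈ unit k D = 0 := by
  simp only [incl_eq, unit, mk_vd_mk]
  refine mk_congr (c' := 0) ?_ ?_ ?_
  · simp [vd_zero_right k]
  · simp
  · simp only [vd_zero_right k, add_zero, one_smul, smul_zero, zero_add, map_zero]
    exact (Submodule.Quotient.mk_eq_zero _).2 ha

theorem unit_dv_incl {a : D} (ha : a ∈ diffIdeal k D) : unit k D ⊣ᵈ incl k D a = 0 := by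
  simp only [incl_eq, unit, mk_dv_mk]
  refine mk_congr (c' := 0) ?_ ?_ ?_
  · simp [dv_zero_left k]
  · simp
  · simp only [vd_zero_left k, add_zero, one_smul, smul_zero, zero_add, map_zero]
    exact (Submodule.Quotient.mk_eq_zero _).2 ha

end BarHull

end BarHull

/-! ### The universal property of the free dialgebra -/

namespace FreeDi

/-- The product `g x₁ ⊢ ⋯ ⊢ g xₙ ⊢ m`. -/
def foldVd {X E : Type*} [DiMul E] (g : X → E) (l : List X) (m : E) : E := l.foldr (fun x n => g x ⊢ᵈ n) m

/-- The product `m ⊣ g x₁ ⊣ ⋯ ⊣ g xₙ`. -/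
def foldDv {X E : Type*} [DiMul E] (g : X → E) (m : E) (r : List X) : E := r.foldl (fun n x => n ⊣ᵈ g x) m

theorem foldVd_vd (k : Type*) {X E : Type*} [Field k] [AddCommGroup E] [Module k E] [DiMul E]
    [IsDialgebra k E] (g : X → E) (l : List X) (m n : E) :
    foldVd g l m ⊢ᵈ n = foldVd g l (m ⊢ᵈ n) := by
  induction l with
  | nil => rfl
  | cons x l ih =>
    exact (IsDialgebra.vd_assoc k _ _ _).trans (congrArg (fun z => g x ⊢ᵈ z) ih)

theorem foldVd_dv (k : Type*) {X E : Type*} [Field k] [AddCommGroup E] [Module k E] [DiMul E]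
    [IsDialgebra k E] (g : X → E) (l : List X) (m n : E) :
    foldVd g l m ⊣ᵈ n = foldVd g l (m ⊣ᵈ n) := by
  induction l with
  | nil => rfl
  | cons x l ih =>
    exact (IsDialgebra.vd_dv_assoc k _ _ _).symm.trans (congrArg (fun z => g x ⊢ᵈ z) ih)

theorem dv_foldDv (k : Type*) {X E : Type*} [Field k] [AddCommGroup E] [Module k E] [DiMul E]
    [IsDialgebra k E] (g : X → E) (m n : E) (r : List X) :
    n ⊣ᵈ foldDv g m r = foldDv g (n ⊣ᵈ m) r := by
  induction r generalizing m with
  | nil => rfl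
  | cons x r ih =>
    exact (ih _).trans (congrArg (fun z => foldDv g z r) (IsDialgebra.dv_assoc k _ _ _).symm)

/-- A left factor of `⊢` forgets its center: by `(a ⊣ b) ⊢ c = (a ⊢ b) ⊢ c`, letters to the right of
that center act through `⊢`. -/
theorem foldDv_vd (k : Type*) {X E : Type*} [Field k] [AddCommGroup E] [Module k E] [DiMul E]
    [IsDialgebra k E] (g : X → E) (m n : E) (r : List X) :
    foldDv g m r ⊢ᵈ n = m ⊢ᵈ foldVd g r n := by
  induction r generalizing m with
  | nil => rfl
  | cons x r ih =>
    exact (ih _).trans ((IsDialgebra.vd_dv k _ _ _).trans (IsDialgebra.vd_assoc k _ _ _))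

/-- Likewise a right factor of `⊣` forgets its center, by `a ⊣ (b ⊢ c) = a ⊣ (b ⊣ c)`. -/
theorem dv_foldVd (k : Type*) {X E : Type*} [Field k] [AddCommGroup E] [Module k E] [DiMul E]
    [IsDialgebra k E] (g : X → E) (l : List X) (m n : E) :
    n ⊣ᵈ foldVd g l m = foldDv g n l ⊣ᵈ m := by
  induction l generalizing n with
  | nil => rfl
  | cons x l ih =>
    exact (IsDialgebra.dv_vd k _ _ _).trans ((IsDialgebra.dv_assoc k _ _ _).symm.trans (ih _))

/-- The value of a normal diword under an assignment of its letters. -/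
def evalDiword {X E : Type*} [DiMul E] (g : X → E) (u : Diword X) : E := foldVd g u.left (foldDv g (g u.center) u.right)

theorem evalDiword_vd (k : Type*) {X E : Type*} [Field k] [AddCommGroup E] [Module k E] [DiMul E]
    [IsDialgebra k E] (g : X → E) (u v : Diword X) :
    evalDiword g (u ⊢ᵈ v) = evalDiword g u ⊢ᵈ evalDiword g v := by
  rw [evalDiword, evalDiword, foldVd_vd k, foldDv_vd k]
  simp [evalDiword, foldVd, DiMul.vd, Diword.word]

theorem evalDiword_dv (k : Type*) {X E : Type*} [Field k] [AddCommGroup E] [Module k E] [DiMul E]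
    [IsDialgebra k E] (g : X → E) (u v : Diword X) :
    evalDiword g (u ⊣ᵈ v) = evalDiword g u ⊣ᵈ evalDiword g v := by
  rw [evalDiword, evalDiword, foldVd_dv k, evalDiword, dv_foldVd k, dv_foldDv k]
  simp [foldDv, DiMul.dv, Diword.word]

/-- The linear map `D(X) → E` extending an assignment of the letters. -/
noncomputable def lift (k : Type*) {X E : Type*} [Field k] [AddCommGroup E] [Module k E] [DiMul E] (g : X → E) : FreeDi k X →ₗ[k] E := Finsupp.linearCombination k (evalDiword g)

theorem lift_gen (k : Type*) {X E : Type*} [Field k] [AddCommGroup E] [Module k E] [DiMul E] (g : X → E) (y : X) : lift k g (gen k y) = g y := by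
  simp [lift, gen, evalDiword, foldVd, foldDv]

theorem isDialgebraHom_lift (k : Type*) {X E : Type*} [Field k] [AddCommGroup E] [Module k E] [DiMul E]
    [IsDialgebra k E] (g : X → E) : IsDialgebraHom (lift k g) := by
  intro a b
  induction a using Finsupp.induction_linear with
  | zero =>
    simp only [map_zero, vd_zero_left k, dv_zero_left k, and_self]
  | add f f' hf hf' =>
    simp only [map_add, IsDialgebra.add_vd k, IsDialgebra.add_dv k, hf, hf',
      and_self]
  | single u s =>
    induction b using Finsupp.induction_linear with
    | zero =>
      simp only [map_zero, vd_zero_right k, dv_zero_right k, and_self]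
    | add f f' hf hf' =>
      simp only [map_add, IsDialgebra.vd_add k, IsDialgebra.dv_add k, hf, hf',
        and_self]
    | single v t =>
      simp only [single_vd_single, single_dv_single, lift, Finsupp.linearCombination_single,
        evalDiword_vd k, evalDiword_dv k, IsDialgebra.smul_vd, IsDialgebra.vd_smul,
        IsDialgebra.smul_dv, IsDialgebra.dv_smul, mul_smul, smul_comm s t, and_self]

end FreeDi

theorem isDiIdeal_ker {k D E : Type*} [Field k] [AddCommGroup D] [Module k D] [DiMul D]
    [AddCommGroup E] [Module k E] [DiMul E] [IsDialgebra k E] {φ : D →ₗ[k] E}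
    (hφ : IsDialgebraHom φ) : IsDiIdeal (LinearMap.ker φ) := by
  intro a z hz
  simp only [LinearMap.mem_ker] at hz ⊢
  simp only [(hφ _ _).1, (hφ _ _).2, hz, vd_zero_left k, vd_zero_right k, dv_zero_left k,
    dv_zero_right k, and_self]

/-- A vector space has a well-ordered basis extending a basis of a given subspace. -/
theorem exists_wellOrdered_basis_span_eq {k : Type u} {D : Type v} [Field k] [AddCommGroup D]
    [Module k D] (A : Submodule k D) :
    ∃ (I : Type v) (_ : LinearOrder I) (_ : WellFoundedLT I) (x : Module.Basis I k D)
        (I₀ : Set I), Submodule.span k (x '' I₀) = A := by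
  let b := Module.Basis.ofVectorSpace k A
  let s : Set D := Set.range fun i => (b i : D)
  have hs : LinearIndepOn k id s :=
    (b.linearIndependent.map' A.subtype A.ker_subtype).linearIndepOn_id
  -- Any well-order of the index set will do; it need not be compatible with the subset indexing the
  -- basis of `A`.
  obtain ⟨r, hr⟩ := exists_wellFoundedLT (hs.extend (Set.subset_univ s))
  refine ⟨_, r, hr, Module.Basis.extend hs, {i | (i : D) ∈ s}, ?_⟩
  have : Module.Basis.extend hs '' {i | (i : D) ∈ s} = s := by
    ext d
    constructor
    · rintro ⟨i, hi, rfl⟩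
      rwa [Module.Basis.extend_apply_self]
    · intro hd
      exact ⟨⟨d, hs.subset_extend _ hd⟩, hd, Module.Basis.extend_apply_self _ _⟩
  rw [this]
  have h2 : s = A.subtype '' Set.range b := by
    rw [← Set.range_comp]; rfl
  rw [h2, ← Submodule.map_span, b.span_eq, Submodule.map_top, Submodule.range_subtype]

/-! ### Relations with linear tails -/

theorem DiCtx.length_fill {X : Type*} (C : DiCtx X) (u : Diword X) :
    (C.fill u).length = C.pre.length + u.length + C.post.length := by
  cases C <;> simp [DiCtx.fill, DiCtx.pre, DiCtx.post, Diword.length, Diword.word] <;> omega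

namespace FreeDi

section Letters

variable {k X : Type*} [Field k]

variable (k X) in
/-- The span of the letters. -/
noncomputable def letters : Submodule k (FreeDi k X) := Submodule.span k (Set.range (gen k))

theorem gen_mem_letters (y : X) : gen k y ∈ letters k X := Submodule.subset_span ⟨y, rfl⟩

theorem left_right_eq_nil_of_mem_letters {t : FreeDi k X} (ht : t ∈ letters k X) {u : Diword X}
    (hu : u ∈ t.support) : u.left = [] ∧ u.right = [] := by
  have h : letters k X ≤ Finsupp.supported k k {u | u.left = [] ∧ u.right = []} := by
    rw [letters, Submodule.span_le]
    rintro _ ⟨y, rfl⟩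
    exact Finsupp.single_mem_supported k 1 ⟨rfl, rfl⟩
  exact (Finsupp.mem_supported k t).1 (h ht) hu

theorem length_eq_one_of_mem_letters {t : FreeDi k X} (ht : t ∈ letters k X) {u : Diword X}
    (hu : u ∈ t.support) : u.length = 1 := by
  obtain ⟨h₁, h₂⟩ := left_right_eq_nil_of_mem_letters ht hu
  simp [Diword.length, Diword.word, h₁, h₂]

theorem eq_or_mem_of_mem_support_single_sub {u v : Diword X} {t : FreeDi k X}
    (hv : v ∈ (Finsupp.single u 1 - t).support) : v = u ∨ v ∈ t.support := by
  by_cases h : v = u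
  · exact Or.inl h
  · right
    simpa [Finsupp.single_apply, Ne.symm h] using hv

theorem single_sub_apply_self {u : Diword X} {t : FreeDi k X} (hu : 2 ≤ u.length)
    (ht : t ∈ letters k X) : (Finsupp.single u 1 - t : FreeDi k X) u = 1 := by
  have h : t u = 0 := by
    by_contra h
    have := length_eq_one_of_mem_letters ht (Finsupp.mem_support_iff.2 h)
    omega
  simp [h]

theorem mem_support_single_sub {u : Diword X} {t : FreeDi k X} (hu : 2 ≤ u.length)
    (ht : t ∈ letters k X) : u ∈ (Finsupp.single u 1 - t : FreeDi k X).support := by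
  simp [-Finsupp.coe_sub, single_sub_apply_self hu ht]

/-- The order compares lengths first, so a linear tail is always smaller, whatever the order on
letters. -/
theorem isLeading_single_sub [LT X] {u : Diword X} {t : FreeDi k X} (hu : 2 ≤ u.length)
    (ht : t ∈ letters k X) : IsLeading (Finsupp.single u 1 - t) u := by
  refine ⟨mem_support_single_sub hu ht, fun v hv hne => Or.inl ?_⟩
  have := length_eq_one_of_mem_letters ht
    ((eq_or_mem_of_mem_support_single_sub hv).resolve_left hne)
  omega

theorem eq_of_isLeading_single_sub [LT X] {u v : Diword X} {t : FreeDi k X} (hu : 2 ≤ u.length)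
    (ht : t ∈ letters k X) (hv : IsLeading (Finsupp.single u 1 - t) v) : v = u := by
  by_contra hne
  have h₁ := length_eq_one_of_mem_letters ht
    ((eq_or_mem_of_mem_support_single_sub hv.1).resolve_left hne)
  rcases hv.2 u (mem_support_single_sub hu ht) (Ne.symm hne) with h | h
  · omega
  · omega

theorem isMonic_single_sub [LT X] {u : Diword X} {t : FreeDi k X} (hu : 2 ≤ u.length)
    (ht : t ∈ letters k X) : IsMonic (Finsupp.single u 1 - t) :=
  ⟨u, isLeading_single_sub hu ht, single_sub_apply_self hu ht⟩

theorem leftNormed_single_sub {u : Diword X} {t : FreeDi k X} (hu : u.right = [])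
    (ht : t ∈ letters k X) : LeftNormed (Finsupp.single u 1 - t) := by
  intro v hv
  rcases eq_or_mem_of_mem_support_single_sub hv with rfl | h
  · exact hu
  · exact (left_right_eq_nil_of_mem_letters ht h).2

theorem rightNormed_single_sub {u : Diword X} {t : FreeDi k X} (hu : u.left = [])
    (ht : t ∈ letters k X) : RightNormed (Finsupp.single u 1 - t) := by
  intro v hv
  rcases eq_or_mem_of_mem_support_single_sub hv with rfl | h
  · exact hu
  · exact (left_right_eq_nil_of_mem_letters ht h).1

theorem gen_vd_gen (p q : X) : gen k p ⊢ᵈ gen k q = Finsupp.single ⟨[p], q, []⟩ 1 := by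
  rw [gen, gen, single_vd_single, mul_one]; rfl

theorem gen_dv_gen (p q : X) : gen k p ⊣ᵈ gen k q = Finsupp.single ⟨[], p, [q]⟩ 1 := by
  rw [gen, gen, single_dv_single, mul_one]; rfl

theorem leftNormed_app {C : DiCtx X} (hC : ∀ u : Diword X, u.right = [] → (C.fill u).right = [])
    {s : FreeDi k X} (hs : LeftNormed s) : LeftNormed (C.app s) := by
  classical
  intro v hv
  obtain ⟨u, hu, rfl⟩ := Finset.mem_image.1 (Finsupp.mapDomain_support hv)
  exact hC u (hs u hu)

theorem rightNormed_app {C : DiCtx X} (hC : ∀ u : Diword X, u.left = [] → (C.fill u).left = [])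
    {s : FreeDi k X} (hs : RightNormed s) : RightNormed (C.app s) := by
  classical
  intro v hv
  obtain ⟨u, hu, rfl⟩ := Finset.mem_image.1 (Finsupp.mapDomain_support hv)
  exact hC u (hs u hu)

theorem app_mid_nil_nil (s : FreeDi k X) : (DiCtx.mid [] []).app s = s := DiCtx.app_mid [] [] s

theorem app_mid_nil_singleton (y : X) (s : FreeDi k X) :
    (DiCtx.mid [] [y]).app s = s ⊣ᵈ gen k y := DiCtx.app_mid [] [y] s

theorem app_mid_singleton_nil (y : X) (s : FreeDi k X) :
    (DiCtx.mid [y] []).app s = gen k y ⊢ᵈ s := DiCtx.app_mid [y] [] s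

theorem app_lft_singleton (y : X) (s : FreeDi k X) :
    (DiCtx.lft [] [] y []).app s = s ⊢ᵈ gen k y := DiCtx.app_lft [] [] y [] s

theorem app_rgt_singleton (y : X) (s : FreeDi k X) :
    (DiCtx.rgt [] y [] []).app s = gen k y ⊣ᵈ s := DiCtx.app_rgt [] y [] [] s

/-- The degree of `[asb]` when `s` has a linear tail. -/
theorem length_fill_le_deg_app (C : DiCtx X) {u : Diword X} {t : FreeDi k X} (hu : 2 ≤ u.length)
    (ht : t ∈ letters k X) : (C.fill u).length ≤ deg (C.app (Finsupp.single u 1 - t)) := by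
  classical
  refine Finset.le_sup (f := Diword.length) (Finsupp.mem_support_iff.2 ?_)
  -- The words coming from the tail are strictly shorter, so they cannot cancel the filled leading
  -- diword.
  have h : (C.app t) (C.fill u) = 0 := by
    by_contra h
    obtain ⟨v, hv, h⟩ := Finset.mem_image.1
      (Finsupp.mapDomain_support (Finsupp.mem_support_iff.2 h))
    have h₁ := length_eq_one_of_mem_letters ht hv
    have h₂ := congrArg Diword.length h
    rw [DiCtx.length_fill, DiCtx.length_fill] at h₂
    omega
  have h' : C.app (Finsupp.single u 1 - t) = Finsupp.single (C.fill u) 1 - C.app t := by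
    rw [← Finsupp.mapDomain_single]
    exact map_sub (Finsupp.mapDomain.addMonoidHom C.fill) _ _
  rw [h', Finsupp.sub_apply, h]
  simp

end Letters

end FreeDi

/-! ### The relations of the bar extension -/

section BarRelations

open FreeDi

variable {k D I : Type*} [Field k] [AddCommGroup D] [Module k D] [DiMul D]

/-- `p ⊢ q - t` is one of the relations for the product `⊢`. -/
def VdRel (x : Module.Basis I k D) (I₀ : Set I) (p q : WithTop I) (t : FreeDi k (WithTop I)) :
    Prop :=
  (∃ i j : I, p = i ∧ q = j ∧ t = barLift x (x i ⊢ᵈ x j)) ∨ (p = ⊤ ∧ t = gen k q) ∨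
    ∃ i ∈ I₀, p = (i : WithTop I) ∧ q = ⊤ ∧ t = 0

/-- `p ⊣ q - t` is one of the relations for the product `⊣`. -/
def DvRel (x : Module.Basis I k D) (I₀ : Set I) (p q : WithTop I) (t : FreeDi k (WithTop I)) :
    Prop :=
  (∃ i j : I, p = i ∧ q = j ∧ t = barLift x (x i ⊣ᵈ x j)) ∨ (q = ⊤ ∧ t = gen k p) ∨
    ∃ i ∈ I₀, q = (i : WithTop I) ∧ p = ⊤ ∧ t = 0

variable {x : Module.Basis I k D} {I₀ : Set I}

/-- The three families exclude one another according to which of `p`, `q` is `e`. This is what makes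
a relation determined by its leading diword. -/
theorem VdRel.unique {p q : WithTop I} {t t' : FreeDi k (WithTop I)} (h : VdRel x I₀ p q t)
    (h' : VdRel x I₀ p q t') : t = t' := by
  rcases h with ⟨i, j, rfl, rfl, rfl⟩ | ⟨rfl, rfl⟩ | ⟨i, hi, rfl, rfl, rfl⟩ <;>
  rcases h' with ⟨i', j', h₁, h₂, rfl⟩ | ⟨h₁, rfl⟩ | ⟨i', hi', h₁, h₂, rfl⟩ <;>
  simp_all

theorem DvRel.unique {p q : WithTop I} {t t' : FreeDi k (WithTop I)} (h : DvRel x I₀ p q t)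
    (h' : DvRel x I₀ p q t') : t = t' := by
  rcases h with ⟨i, j, rfl, rfl, rfl⟩ | ⟨rfl, rfl⟩ | ⟨i, hi, rfl, rfl, rfl⟩ <;>
  rcases h' with ⟨i', j', h₁, h₂, rfl⟩ | ⟨h₁, rfl⟩ | ⟨i', hi', h₁, h₂, rfl⟩ <;>
  simp_all

theorem VdRel.mem_barRel {p q : WithTop I} {t : FreeDi k (WithTop I)} (h : VdRel x I₀ p q t) :
    gen k p ⊢ᵈ gen k q - t ∈ barRel x I₀ := by
  rcases h with ⟨i, j, rfl, rfl, rfl⟩ | ⟨rfl, rfl⟩ | ⟨i, hi, rfl, rfl, rfl⟩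
  · exact Or.inl (Or.inl (Or.inl (Or.inl (Or.inl ⟨i, j, rfl⟩))))
  · exact Or.inl (Or.inl (Or.inl (Or.inr ⟨q, rfl⟩)))
  · exact Or.inl (Or.inr ⟨i, hi, sub_zero _⟩)

theorem DvRel.mem_barRel {p q : WithTop I} {t : FreeDi k (WithTop I)} (h : DvRel x I₀ p q t) :
    gen k p ⊣ᵈ gen k q - t ∈ barRel x I₀ := by
  rcases h with ⟨i, j, rfl, rfl, rfl⟩ | ⟨rfl, rfl⟩ | ⟨i, hi, rfl, rfl, rfl⟩
  · exact Or.inl (Or.inl (Or.inl (Or.inl (Or.inr ⟨i, j, rfl⟩))))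
  · exact Or.inl (Or.inl (Or.inr ⟨p, rfl⟩))
  · exact Or.inr ⟨i, hi, sub_zero _⟩

theorem exists_rel_of_mem_barRel {s : FreeDi k (WithTop I)} (hs : s ∈ barRel x I₀) :
    (∃ p q t, VdRel x I₀ p q t ∧ s = gen k p ⊢ᵈ gen k q - t) ∨
      ∃ p q t, DvRel x I₀ p q t ∧ s = gen k p ⊣ᵈ gen k q - t := by
  rcases hs with ((((⟨i, j, rfl⟩ | ⟨i, j, rfl⟩) | ⟨y, rfl⟩) | ⟨y, rfl⟩) | ⟨i, hi, rfl⟩) | ⟨i, hi, rfl⟩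
  · exact Or.inl ⟨_, _, _, Or.inl ⟨i, j, rfl, rfl, rfl⟩, rfl⟩
  · exact Or.inr ⟨_, _, _, Or.inl ⟨i, j, rfl, rfl, rfl⟩, rfl⟩
  · exact Or.inl ⟨_, _, _, Or.inr (Or.inl ⟨rfl, rfl⟩), rfl⟩
  · exact Or.inr ⟨_, _, _, Or.inr (Or.inl ⟨rfl, rfl⟩), rfl⟩
  · exact Or.inl ⟨_, _, _, Or.inr (Or.inr ⟨i, hi, rfl, rfl, rfl⟩), (sub_zero _).symm⟩
  · exact Or.inr ⟨_, _, _, Or.inr (Or.inr ⟨i, hi, rfl, rfl, rfl⟩), (sub_zero _).symm⟩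

omit [DiMul D] in
theorem Module.Basis.map_mem {M : Type*} [AddCommGroup M] [Module k M] (x : Module.Basis I k D)
    (φ : D →ₗ[k] M) (N : Submodule k M) (h : ∀ i, φ (x i) ∈ N) (d : D) : φ d ∈ N := by
  have : ⊤ ≤ N.comap φ := by
    rw [← x.span_eq, Submodule.span_le]
    rintro _ ⟨i, rfl⟩
    exact h i
  exact this Submodule.mem_top

omit [DiMul D] in
theorem barLift_basis (x : Module.Basis I k D) (i : I) : barLift x (x i) = gen k (i : WithTop I) :=
  x.constr_basis k _ i

omit [DiMul D] in
theorem barLift_mem_letters (x : Module.Basis I k D) (d : D) :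
    barLift x d ∈ letters k (WithTop I) :=
  x.map_mem _ _ (fun i => by rw [barLift_basis]; exact gen_mem_letters _) d

theorem VdRel.mem_letters {p q : WithTop I} {t : FreeDi k (WithTop I)} (h : VdRel x I₀ p q t) :
    t ∈ letters k (WithTop I) := by
  rcases h with ⟨i, j, rfl, rfl, rfl⟩ | ⟨rfl, rfl⟩ | ⟨i, hi, rfl, rfl, rfl⟩
  · exact barLift_mem_letters x _
  · exact gen_mem_letters q
  · exact zero_mem _

theorem DvRel.mem_letters {p q : WithTop I} {t : FreeDi k (WithTop I)} (h : DvRel x I₀ p q t) :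
    t ∈ letters k (WithTop I) := by
  rcases h with ⟨i, j, rfl, rfl, rfl⟩ | ⟨rfl, rfl⟩ | ⟨i, hi, rfl, rfl, rfl⟩
  · exact barLift_mem_letters x _
  · exact gen_mem_letters p
  · exact zero_mem _

/-! ### Identities modulo the linear spans of the relations -/

variable (x I₀)

/-- The span of the relations for the product `⊢`. -/
noncomputable def vdSpan : Submodule k (FreeDi k (WithTop I)) :=
  Submodule.span k {s | ∃ p q t, VdRel x I₀ p q t ∧ s = gen k p ⊢ᵈ gen k q - t}

/-- The span of the relations for the product `⊣`. -/
noncomputable def dvSpan : Submodule k (FreeDi k (WithTop I)) :=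
  Submodule.span k {s | ∃ p q t, DvRel x I₀ p q t ∧ s = gen k p ⊣ᵈ gen k q - t}

variable {x I₀}

theorem VdRel.mem_vdSpan {p q : WithTop I} {t : FreeDi k (WithTop I)} (h : VdRel x I₀ p q t) :
    gen k p ⊢ᵈ gen k q - t ∈ vdSpan x I₀ := Submodule.subset_span ⟨p, q, t, h, rfl⟩

theorem DvRel.mem_dvSpan {p q : WithTop I} {t : FreeDi k (WithTop I)} (h : DvRel x I₀ p q t) :
    gen k p ⊣ᵈ gen k q - t ∈ dvSpan x I₀ := Submodule.subset_span ⟨p, q, t, h, rfl⟩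

theorem vdSpan_le_diIdeal : vdSpan x I₀ ≤ diIdeal k (barRel x I₀) := by
  rw [vdSpan, Submodule.span_le]
  rintro _ ⟨p, q, t, h, rfl⟩
  exact subset_diIdeal _ h.mem_barRel

theorem dvSpan_le_diIdeal : dvSpan x I₀ ≤ diIdeal k (barRel x I₀) := by
  rw [dvSpan, Submodule.span_le]
  rintro _ ⟨p, q, t, h, rfl⟩
  exact subset_diIdeal _ h.mem_barRel

theorem top_vd_sub_mem {t : FreeDi k (WithTop I)} (ht : t ∈ letters k (WithTop I)) :
    gen k ⊤ ⊢ᵈ t - t ∈ vdSpan x I₀ := by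
  have : letters k (WithTop I) ≤
      (vdSpan x I₀).comap (vdMap k _ (gen k (⊤ : WithTop I)) - LinearMap.id) := by
    rw [letters, Submodule.span_le]
    rintro _ ⟨y, rfl⟩
    exact VdRel.mem_vdSpan (Or.inr (Or.inl ⟨rfl, rfl⟩))
  exact this ht

theorem dv_top_sub_mem {t : FreeDi k (WithTop I)} (ht : t ∈ letters k (WithTop I)) :
    t ⊣ᵈ gen k ⊤ - t ∈ dvSpan x I₀ := by
  have : letters k (WithTop I) ≤
      (dvSpan x I₀).comap ((dvMap k _).flip (gen k (⊤ : WithTop I)) - LinearMap.id) := by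
    rw [letters, Submodule.span_le]
    rintro _ ⟨y, rfl⟩
    exact DvRel.mem_dvSpan (Or.inr (Or.inl ⟨rfl, rfl⟩))
  exact this ht

variable [IsDialgebra k D]

/-- The multiplication table is imposed only on basis elements; bilinearity extends it to all of
`D`. -/
theorem barLift_vd_sub_mem (a b : D) :
    barLift x a ⊢ᵈ barLift x b - barLift x (a ⊢ᵈ b) ∈ vdSpan x I₀ := by
  refine x.map_mem ((vdMap k _ (barLift x a)) ∘ₗ barLift x - barLift x ∘ₗ vdMap k D a) _
    (fun j => ?_) b
  refine x.map_mem ((vdMap k _).flip (barLift x (x j)) ∘ₗ barLift x -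
    barLift x ∘ₗ (vdMap k D).flip (x j)) _ (fun i => ?_) a
  simp only [LinearMap.sub_apply, LinearMap.comp_apply, LinearMap.flip_apply, vdMap_apply,
    barLift_basis]
  exact VdRel.mem_vdSpan (Or.inl ⟨i, j, rfl, rfl, rfl⟩)

theorem barLift_dv_sub_mem (a b : D) :
    barLift x a ⊣ᵈ barLift x b - barLift x (a ⊣ᵈ b) ∈ dvSpan x I₀ := by
  refine x.map_mem ((dvMap k _ (barLift x a)) ∘ₗ barLift x - barLift x ∘ₗ dvMap k D a) _
    (fun j => ?_) b
  refine x.map_mem ((dvMap k _).flip (barLift x (x j)) ∘ₗ barLift x -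
    barLift x ∘ₗ (dvMap k D).flip (x j)) _ (fun i => ?_) a
  simp only [LinearMap.sub_apply, LinearMap.comp_apply, LinearMap.flip_apply, dvMap_apply,
    barLift_basis]
  exact DvRel.mem_dvSpan (Or.inl ⟨i, j, rfl, rfl, rfl⟩)

variable (hI₀ : Submodule.span k (x '' I₀) = diffIdeal k D)

include hI₀

omit [IsDialgebra k D] in
theorem basis_mem_diffIdeal {i : I} (hi : i ∈ I₀) : x i ∈ diffIdeal k D :=
  hI₀ ▸ Submodule.subset_span ⟨i, hi, rfl⟩

/-- Elements of `A` are annihilated on the right through `⊢`, up to the relations. -/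
theorem barLift_vd_gen_mem {a : D} (ha : a ∈ diffIdeal k D) (y : WithTop I) :
    barLift x a ⊢ᵈ gen k y ∈ vdSpan x I₀ := by
  induction y using WithTop.recTopCoe with
  | top =>
    -- Against `e`, the relations `x₀ ⊢ e` suffice because the `x₀` span `A`.
    have : diffIdeal k D ≤
        (vdSpan x I₀).comap ((vdMap k _).flip (gen k (⊤ : WithTop I)) ∘ₗ barLift x) := by
      rw [← hI₀, Submodule.span_le]
      rintro _ ⟨i, hi, rfl⟩
      have h : VdRel x I₀ i ⊤ 0 := Or.inr (Or.inr ⟨i, hi, rfl, rfl, rfl⟩)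
      simpa [vdMap_apply, barLift_basis] using h.mem_vdSpan
    exact this ha
  | coe j =>
    -- Against a letter of `X`, the product already vanishes in `D`, so the multiplication table
    -- gives the claim.
    have h := barLift_vd_sub_mem (x := x) (I₀ := I₀) a (x j)
    rwa [(annihilates_of_mem_diffIdeal ha _).1, map_zero, sub_zero, barLift_basis] at h

/-- Elements of `A` are annihilated on the left through `⊣`, up to the relations. -/
theorem gen_dv_barLift_mem {a : D} (ha : a ∈ diffIdeal k D) (y : WithTop I) :
    gen k y ⊣ᵈ barLift x a ∈ dvSpan x I₀ := by
  induction y using WithTop.recTopCoe with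
  | top =>
    have : diffIdeal k D ≤
        (dvSpan x I₀).comap (dvMap k _ (gen k (⊤ : WithTop I)) ∘ₗ barLift x) := by
      rw [← hI₀, Submodule.span_le]
      rintro _ ⟨i, hi, rfl⟩
      have h : DvRel x I₀ ⊤ i 0 := Or.inr (Or.inr ⟨i, hi, rfl, rfl, rfl⟩)
      simpa [dvMap_apply, barLift_basis] using h.mem_dvSpan
    exact this ha
  | coe j =>
    have h := barLift_dv_sub_mem (x := x) (I₀ := I₀) (x j) a
    rwa [(annihilates_of_mem_diffIdeal ha _).2, map_zero, sub_zero, barLift_basis] at h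

/-- Overlaps of two relations for `⊢`. -/
theorem VdRel.overlap_mem {p q r : WithTop I} {t t' : FreeDi k (WithTop I)}
    (h : VdRel x I₀ p q t) (h' : VdRel x I₀ q r t') :
    (gen k p ⊢ᵈ gen k q - t) ⊢ᵈ gen k r - gen k p ⊢ᵈ (gen k q ⊢ᵈ gen k r - t') ∈ vdSpan x I₀ := by
  have e : (gen k p ⊢ᵈ gen k q - t) ⊢ᵈ gen k r - gen k p ⊢ᵈ (gen k q ⊢ᵈ gen k r - t') =
      gen k p ⊢ᵈ t' - t ⊢ᵈ gen k r := by
    rw [vd_sub_left k, vd_sub_right k, IsDialgebra.vd_assoc k]; abel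
  rw [e]
  have ht' := h'.mem_letters
  rcases h with ⟨i, j, rfl, rfl, rfl⟩ | ⟨rfl, rfl⟩ | ⟨i, hi, rfl, rfl, rfl⟩
  · rcases h' with ⟨i', l, hj, rfl, rfl⟩ | ⟨hj, -⟩ | ⟨i', hi', hj, rfl, rfl⟩
    · obtain rfl := WithTop.coe_injective hj
      have h₁ := barLift_vd_sub_mem (x := x) (I₀ := I₀) (x i) (x j ⊢ᵈ x l)
      have h₂ := barLift_vd_sub_mem (x := x) (I₀ := I₀) (x i ⊢ᵈ x j) (x l)
      rw [IsDialgebra.vd_assoc k] at h₂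
      rw [← barLift_basis x i, ← barLift_basis x l]
      convert sub_mem h₁ h₂ using 1
      abel
    · exact absurd hj (WithTop.coe_ne_top)
    · obtain rfl := WithTop.coe_injective hj
      -- The overlap is `x_i ⊢ x_j ⊢ e` with `x_j` in `A`; what is left is the product of `{x_i ⊢
      -- x_j}` with `e`, and `x_i ⊢ x_j` lies in `A` because `A` is an ideal.
      rw [vd_zero, zero_sub]
      exact neg_mem (barLift_vd_gen_mem hI₀ ((isDiIdeal_diffIdeal k D _ _
        (basis_mem_diffIdeal hI₀ hi')).1) _)
  -- With `p = e`, both `e ⊢ t'` and `q ⊢ r` reduce to `t'`.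
  · convert sub_mem (top_vd_sub_mem (x := x) (I₀ := I₀) ht') h'.mem_vdSpan using 1
    abel
  · rcases h' with ⟨i', l, hj, rfl, rfl⟩ | ⟨-, rfl⟩ | ⟨i', hi', hj, rfl, rfl⟩
    · exact absurd hj.symm (WithTop.coe_ne_top)
    · rw [zero_vd, sub_zero, ← barLift_basis x i]
      exact barLift_vd_gen_mem hI₀ (basis_mem_diffIdeal hI₀ hi) _
    · exact absurd hj.symm (WithTop.coe_ne_top)

/-- Overlaps of two relations for `⊣`. -/
theorem DvRel.overlap_mem {p q r : WithTop I} {t t' : FreeDi k (WithTop I)}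
    (h : DvRel x I₀ p q t) (h' : DvRel x I₀ q r t') :
    (gen k p ⊣ᵈ gen k q - t) ⊣ᵈ gen k r - gen k p ⊣ᵈ (gen k q ⊣ᵈ gen k r - t') ∈ dvSpan x I₀ := by
  have e : (gen k p ⊣ᵈ gen k q - t) ⊣ᵈ gen k r - gen k p ⊣ᵈ (gen k q ⊣ᵈ gen k r - t') =
      gen k p ⊣ᵈ t' - t ⊣ᵈ gen k r := by
    rw [dv_sub_left k, dv_sub_right k, IsDialgebra.dv_assoc k]; abel
  rw [e]
  have ht := h.mem_letters
  rcases h' with ⟨j, l, rfl, rfl, rfl⟩ | ⟨rfl, rfl⟩ | ⟨i, hi, rfl, rfl, rfl⟩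
  · rcases h with ⟨i, j', rfl, hj, rfl⟩ | ⟨hj, -⟩ | ⟨i', hi', hj, rfl, rfl⟩
    · obtain rfl := WithTop.coe_injective hj
      have h₁ := barLift_dv_sub_mem (x := x) (I₀ := I₀) (x i) (x j ⊣ᵈ x l)
      have h₂ := barLift_dv_sub_mem (x := x) (I₀ := I₀) (x i ⊣ᵈ x j) (x l)
      rw [IsDialgebra.dv_assoc k] at h₂
      rw [← barLift_basis x i, ← barLift_basis x l]
      convert sub_mem h₁ h₂ using 1
      abel
    · exact absurd hj (WithTop.coe_ne_top)
    · obtain rfl := WithTop.coe_injective hj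
      rw [zero_dv, sub_zero]
      exact gen_dv_barLift_mem hI₀ ((isDiIdeal_diffIdeal k D _ _
        (basis_mem_diffIdeal hI₀ hi')).2.2.2) _
  · convert sub_mem h.mem_dvSpan (dv_top_sub_mem (x := x) (I₀ := I₀) ht) using 1
    abel
  · rcases h with ⟨i', l, rfl, hj, rfl⟩ | ⟨-, rfl⟩ | ⟨i', hi', hj, rfl, rfl⟩
    · exact absurd hj.symm (WithTop.coe_ne_top)
    · rw [dv_zero, zero_sub, ← barLift_basis x i]
      exact neg_mem (gen_dv_barLift_mem hI₀ (basis_mem_diffIdeal hI₀ hi) _)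
    · exact absurd hj.symm (WithTop.coe_ne_top)

omit hI₀ in
/-- Overlaps of a relation for `⊢` and a relation for `⊣`. -/
theorem VdRel.overlap_dvRel_mem {p q r : WithTop I} {t t' : FreeDi k (WithTop I)}
    (h : VdRel x I₀ p q t) (h' : DvRel x I₀ q r t') :
    (gen k p ⊢ᵈ gen k q - t) ⊣ᵈ gen k r - gen k p ⊢ᵈ (gen k q ⊣ᵈ gen k r - t') ∈
      vdSpan x I₀ ⊔ dvSpan x I₀ := by
  have e : (gen k p ⊢ᵈ gen k q - t) ⊣ᵈ gen k r - gen k p ⊢ᵈ (gen k q ⊣ᵈ gen k r - t') =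
      gen k p ⊢ᵈ t' - t ⊣ᵈ gen k r := by
    rw [dv_sub_left k, vd_sub_right k, IsDialgebra.vd_dv_assoc k]; abel
  rw [e]
  have ht' := h'.mem_letters
  have ht := h.mem_letters
  have h₀ := h
  rcases h with ⟨i, j, rfl, rfl, rfl⟩ | ⟨rfl, rfl⟩ | ⟨i, hi, rfl, rfl, rfl⟩
  · rcases h' with ⟨i', l, hj, rfl, rfl⟩ | ⟨rfl, rfl⟩ | ⟨i', hi', -, hj, rfl⟩
    · obtain rfl := WithTop.coe_injective hj
      -- The law `a ⊢ (b ⊣ c) = (a ⊢ b) ⊣ c` has outer product `⊢` on one side and `⊣` on the other,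
      -- so both spans are needed.
      have h₁ := barLift_vd_sub_mem (x := x) (I₀ := I₀) (x i) (x j ⊣ᵈ x l)
      have h₂ := barLift_dv_sub_mem (x := x) (I₀ := I₀) (x i ⊢ᵈ x j) (x l)
      rw [← IsDialgebra.vd_dv_assoc k] at h₂
      rw [← barLift_basis x i, ← barLift_basis x l]
      convert sub_mem (Submodule.mem_sup_left h₁) (Submodule.mem_sup_right h₂) using 1
      abel
    · convert sub_mem (Submodule.mem_sup_left h₀.mem_vdSpan)
        (Submodule.mem_sup_right (dv_top_sub_mem (x := x) (I₀ := I₀) ht)) using 1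
      abel
    · exact absurd hj (WithTop.coe_ne_top)
  · convert sub_mem (Submodule.mem_sup_left (top_vd_sub_mem (x := x) (I₀ := I₀) ht'))
      (Submodule.mem_sup_right h'.mem_dvSpan) using 1
    abel
  · rw [zero_dv, sub_zero]
    rcases h' with ⟨i', l, hj, rfl, rfl⟩ | ⟨-, rfl⟩ | ⟨i', hi', rfl, -, rfl⟩
    · exact absurd hj.symm (WithTop.coe_ne_top)
    · simpa using Submodule.mem_sup_left h₀.mem_vdSpan
    · rw [vd_zero]
      exact zero_mem _

end BarRelations

/-! ### The relations form a Gröbner–Shirshov basis -/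

namespace FreeDi

variable {k X : Type*} [Field k] [LT X]

/-- The span of the right normed `S`-diwords of length at most `n`. -/
noncomputable def rightNormedSpan (S : Set (FreeDi k X)) (n : ℕ) : Submodule k (FreeDi k X) :=
  Submodule.span k {p : FreeDi k X | ∃ s ∈ S, ∃ (C : DiCtx X) (u : Diword X),
    IsLeading s u ∧ C.IsRightNormed s ∧ (C.fill u).length ≤ n ∧ p = C.app s}

/-- The span of the left normed `S`-diwords of length at most `n`. -/
noncomputable def leftNormedSpan (S : Set (FreeDi k X)) (n : ℕ) : Submodule k (FreeDi k X) :=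
  Submodule.span k {p : FreeDi k X | ∃ s ∈ S, ∃ (C : DiCtx X) (u : Diword X),
    IsLeading s u ∧ C.IsLeftNormed s ∧ (C.fill u).length ≤ n ∧ p = C.app s}

theorem trivialAt_of_eq {S : Set (FreeDi k X)} {w : Diword X} {C₁ C₂ : DiCtx X} {f g : FreeDi k X}
    (h : C₁.app f = C₂.app g) : TrivialAt S w C₁ f C₂ g := by
  rw [TrivialAt, h, sub_self]
  exact zero_mem _

end FreeDi

theorem DiCtx.eq_mid_of_pre_post_nil {X : Type*} {C : DiCtx X} (h₁ : C.pre = [])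
    (h₂ : C.post = []) : C = DiCtx.mid [] [] := by
  cases C <;> simp_all [DiCtx.pre, DiCtx.post]

/-- A hole to the right of the center is impossible, since the center would precede it. -/
theorem DiCtx.eq_of_pre_nil {X : Type*} {C : DiCtx X} (h₁ : C.pre = [])
    (h₂ : C.post.length = 1) : ∃ r, C = DiCtx.mid [] [r] ∨ C = DiCtx.lft [] [] r [] := by
  cases C <;> simp_all [DiCtx.pre, DiCtx.post, List.length_eq_one_iff]
  simp only [← List.length_eq_zero_iff]
  omega

theorem DiCtx.eq_of_post_nil {X : Type*} {C : DiCtx X} (h₁ : C.post = [])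
    (h₂ : C.pre.length = 1) : ∃ p, C = DiCtx.mid [p] [] ∨ C = DiCtx.rgt [] p [] [] := by
  cases C <;> simp_all [DiCtx.pre, DiCtx.post, List.length_eq_one_iff]
  simp only [← List.length_eq_zero_iff]
  omega

/-! ### Leading diwords and normedness of the relations -/

section Compositions

open FreeDi

variable {k D I : Type*} [Field k] [AddCommGroup D] [Module k D] [DiMul D] [LinearOrder I]
variable {x : Module.Basis I k D} {I₀ : Set I} {p q : WithTop I} {t : FreeDi k (WithTop I)}

theorem VdRel.isLeading (h : VdRel x I₀ p q t) :
    IsLeading (gen k p ⊢ᵈ gen k q - t) ⟨[p], q, []⟩ := by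
  rw [gen_vd_gen]
  exact isLeading_single_sub le_rfl h.mem_letters

theorem DvRel.isLeading (h : DvRel x I₀ p q t) :
    IsLeading (gen k p ⊣ᵈ gen k q - t) ⟨[], p, [q]⟩ := by
  rw [gen_dv_gen]
  exact isLeading_single_sub le_rfl h.mem_letters

theorem VdRel.eq_of_isLeading (h : VdRel x I₀ p q t) {u : Diword (WithTop I)}
    (hu : IsLeading (gen k p ⊢ᵈ gen k q - t) u) : u = ⟨[p], q, []⟩ := by
  rw [gen_vd_gen] at hu
  exact eq_of_isLeading_single_sub le_rfl h.mem_letters hu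

theorem DvRel.eq_of_isLeading (h : DvRel x I₀ p q t) {u : Diword (WithTop I)}
    (hu : IsLeading (gen k p ⊣ᵈ gen k q - t) u) : u = ⟨[], p, [q]⟩ := by
  rw [gen_dv_gen] at hu
  exact eq_of_isLeading_single_sub le_rfl h.mem_letters hu

omit [LinearOrder I] in
theorem VdRel.leftNormed (h : VdRel x I₀ p q t) : LeftNormed (gen k p ⊢ᵈ gen k q - t) := by
  rw [gen_vd_gen]
  exact leftNormed_single_sub rfl h.mem_letters

omit [LinearOrder I] in
theorem DvRel.rightNormed (h : DvRel x I₀ p q t) : RightNormed (gen k p ⊣ᵈ gen k q - t) := by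
  rw [gen_dv_gen]
  exact rightNormed_single_sub rfl h.mem_letters

theorem VdRel.not_rightNormed (h : VdRel x I₀ p q t) :
    ¬ RightNormed (gen k p ⊢ᵈ gen k q - t) := fun hn =>
  List.cons_ne_nil _ _ (hn _ h.isLeading.1)

theorem DvRel.not_leftNormed (h : DvRel x I₀ p q t) :
    ¬ LeftNormed (gen k p ⊣ᵈ gen k q - t) := fun hn =>
  List.cons_ne_nil _ _ (hn _ h.isLeading.1)

theorem isMonic_of_mem_barRel {s : FreeDi k (WithTop I)} (hs : s ∈ barRel x I₀) : IsMonic s := by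
  rcases exists_rel_of_mem_barRel hs with ⟨p, q, t, h, rfl⟩ | ⟨p, q, t, h, rfl⟩
  · rw [gen_vd_gen]
    exact isMonic_single_sub le_rfl h.mem_letters
  · rw [gen_dv_gen]
    exact isMonic_single_sub le_rfl h.mem_letters

/-- Distinct relations have distinct leading diwords. -/
theorem eq_of_isLeading_of_mem_barRel {f g : FreeDi k (WithTop I)} (hf : f ∈ barRel x I₀)
    (hg : g ∈ barRel x I₀) {u : Diword (WithTop I)} (hfu : IsLeading f u) (hgu : IsLeading g u) :
    f = g := by
  rcases exists_rel_of_mem_barRel hf with ⟨p, q, t, h, rfl⟩ | ⟨p, q, t, h, rfl⟩ <;>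
  rcases exists_rel_of_mem_barRel hg with ⟨p', q', t', h', rfl⟩ | ⟨p', q', t', h', rfl⟩ <;>
  have e := (h.eq_of_isLeading hfu).symm.trans (h'.eq_of_isLeading hgu) <;>
  simp only [Diword.mk.injEq, List.cons.injEq, and_true, true_and, reduceCtorEq, and_false] at e
  · obtain ⟨rfl, rfl⟩ := e
    rw [h.unique h']
  · obtain ⟨rfl, rfl⟩ := e
    rw [h.unique h']

theorem length_of_isLeading_of_mem_barRel {f : FreeDi k (WithTop I)} (hf : f ∈ barRel x I₀)
    {u : Diword (WithTop I)} (hfu : IsLeading f u) : u.length = 2 := by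
  rcases exists_rel_of_mem_barRel hf with ⟨p, q, t, h, rfl⟩ | ⟨p, q, t, h, rfl⟩ <;>
  · rw [h.eq_of_isLeading hfu]; rfl

/-- The `⊢`-relations are left normed, so the left normed requirement always holds; the right normed
one is void by `hn`. The bound below `w` follows from length alone. -/
theorem TrivialAt.of_mem_vdSpan {w : Diword (WithTop I)} {C₁ C₂ : DiCtx (WithTop I)}
    {f g : FreeDi k (WithTop I)} (hw : 2 < w.length) (hn : ¬ RightNormed f ∨ ¬ RightNormed g)
    (h : C₁.app f - C₂.app g ∈ vdSpan x I₀) : TrivialAt (barRel x I₀) w C₁ f C₂ g := by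
  refine Submodule.span_mono ?_ h
  rintro _ ⟨p, q, t, h, rfl⟩
  refine ⟨_, h.mem_barRel, DiCtx.mid [] [], _, h.isLeading, trivial, Or.inl hw, ?_, fun _ => ?_,
    (app_mid_nil_nil _).symm⟩
  · rintro ⟨h₁, h₂⟩
    exact absurd h₂.2.1 (hn.resolve_left (not_not.2 h₁.2.1))
  · exact ⟨trivial, h.leftNormed, by rw [app_mid_nil_nil]; exact h.leftNormed⟩

theorem TrivialAt.of_mem_dvSpan {w : Diword (WithTop I)} {C₁ C₂ : DiCtx (WithTop I)}
    {f g : FreeDi k (WithTop I)} (hw : 2 < w.length) (hn : ¬ LeftNormed f ∨ ¬ LeftNormed g)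
    (h : C₁.app f - C₂.app g ∈ dvSpan x I₀) : TrivialAt (barRel x I₀) w C₁ f C₂ g := by
  refine Submodule.span_mono ?_ h
  rintro _ ⟨p, q, t, h, rfl⟩
  refine ⟨_, h.mem_barRel, DiCtx.mid [] [], _, h.isLeading, trivial, Or.inl hw, fun _ => ?_, ?_,
    (app_mid_nil_nil _).symm⟩
  · exact ⟨trivial, h.rightNormed, by rw [app_mid_nil_nil]; exact h.rightNormed⟩
  · rintro ⟨h₁, h₂⟩
    exact absurd h₂.2.1 (hn.resolve_left (not_not.2 h₁.2.1))

/-- For a mixed overlap neither normedness requirement applies, so relations of both kinds may be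
used. -/
theorem TrivialAt.of_mem_sup {w : Diword (WithTop I)} {C₁ C₂ : DiCtx (WithTop I)}
    {f g : FreeDi k (WithTop I)} (hw : 2 < w.length) (hf : ¬ RightNormed f) (hg : ¬ LeftNormed g)
    (h : C₁.app f - C₂.app g ∈ vdSpan x I₀ ⊔ dvSpan x I₀) :
    TrivialAt (barRel x I₀) w C₁ f C₂ g := by
  refine (show vdSpan x I₀ ⊔ dvSpan x I₀ ≤ Submodule.span k _ from ?_) h
  refine sup_le (Submodule.span_le.2 ?_) (Submodule.span_le.2 ?_) <;>
  · rintro _ ⟨p, q, t, h, rfl⟩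
    exact Submodule.subset_span ⟨_, h.mem_barRel, DiCtx.mid [] [], _, h.isLeading, trivial,
      Or.inl hw, fun h => absurd h.1.2.1 hf, fun h => absurd h.2.2.1 hg, (app_mid_nil_nil _).symm⟩

theorem DvRel.app_mem_rightNormedSpan (h : DvRel x I₀ p q t) {C : DiCtx (WithTop I)}
    (hC : ∀ u : Diword (WithTop I), u.left = [] → (C.fill u).left = [])
    {n : ℕ} (hn : (C.fill ⟨[], p, [q]⟩).length ≤ n) :
    C.app (gen k p ⊣ᵈ gen k q - t) ∈ rightNormedSpan (barRel x I₀) n := by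
  refine Submodule.subset_span ⟨_, h.mem_barRel, C, _, h.isLeading, ⟨?_, h.rightNormed,
    rightNormed_app hC h.rightNormed⟩, hn, rfl⟩
  cases C with
  | mid => trivial
  | rgt => exact h.rightNormed
  -- A hole left of the center always leaves letters before the center, contradicting `hC`.
  | lft a b₁ c b₂ => simpa [DiCtx.fill, Diword.word] using hC ⟨[], p, []⟩ rfl

theorem VdRel.app_mem_leftNormedSpan (h : VdRel x I₀ p q t) {C : DiCtx (WithTop I)}
    (hC : ∀ u : Diword (WithTop I), u.right = [] → (C.fill u).right = [])
    {n : ℕ} (hn : (C.fill ⟨[p], q, []⟩).length ≤ n) :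
    C.app (gen k p ⊢ᵈ gen k q - t) ∈ leftNormedSpan (barRel x I₀) n := by
  refine Submodule.subset_span ⟨_, h.mem_barRel, C, _, h.isLeading, ⟨?_, h.leftNormed,
    leftNormed_app hC h.leftNormed⟩, hn, rfl⟩
  cases C with
  | mid => trivial
  | lft => exact h.leftNormed
  | rgt a₁ c a₂ b => simpa [DiCtx.fill, Diword.word] using hC ⟨[], p, []⟩ rfl

theorem dvSpan_le_rightNormedSpan {n : ℕ} (hn : 2 ≤ n) :
    dvSpan x I₀ ≤ rightNormedSpan (barRel x I₀) n := by
  rw [dvSpan, Submodule.span_le]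
  rintro _ ⟨p, q, t, h, rfl⟩
  rw [← app_mid_nil_nil (gen k p ⊣ᵈ gen k q - t)]
  exact h.app_mem_rightNormedSpan (fun u hu => by simpa [DiCtx.fill] using hu) hn

theorem vdSpan_le_leftNormedSpan {n : ℕ} (hn : 2 ≤ n) :
    vdSpan x I₀ ≤ leftNormedSpan (barRel x I₀) n := by
  rw [vdSpan, Submodule.span_le]
  rintro _ ⟨p, q, t, h, rfl⟩
  rw [← app_mid_nil_nil (gen k p ⊢ᵈ gen k q - t)]
  refine h.app_mem_leftNormedSpan (fun u hu => ?_) hn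
  simpa [DiCtx.fill] using hu

theorem DvRel.gen_dv_mem (h : DvRel x I₀ p q t) (y : WithTop I) {n : ℕ} (hn : 3 ≤ n) :
    gen k y ⊣ᵈ (gen k p ⊣ᵈ gen k q - t) ∈ rightNormedSpan (barRel x I₀) n := by
  rw [← app_rgt_singleton]
  exact h.app_mem_rightNormedSpan (fun u hu => rfl) hn

theorem DvRel.dv_gen_mem (h : DvRel x I₀ p q t) (y : WithTop I) {n : ℕ} (hn : 3 ≤ n) :
    (gen k p ⊣ᵈ gen k q - t) ⊣ᵈ gen k y ∈ rightNormedSpan (barRel x I₀) n := by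
  rw [← app_mid_nil_singleton]
  exact h.app_mem_rightNormedSpan (fun u hu => by simpa [DiCtx.fill] using hu) hn

theorem VdRel.vd_gen_mem (h : VdRel x I₀ p q t) (y : WithTop I) {n : ℕ} (hn : 3 ≤ n) :
    (gen k p ⊢ᵈ gen k q - t) ⊢ᵈ gen k y ∈ leftNormedSpan (barRel x I₀) n := by
  rw [← app_lft_singleton]
  exact h.app_mem_leftNormedSpan (fun u hu => rfl) hn

theorem VdRel.gen_vd_mem (h : VdRel x I₀ p q t) (y : WithTop I) {n : ℕ} (hn : 3 ≤ n) :
    gen k y ⊢ᵈ (gen k p ⊢ᵈ gen k q - t) ∈ leftNormedSpan (barRel x I₀) n := by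
  rw [← app_mid_singleton_nil]
  refine h.app_mem_leftNormedSpan (fun u hu => ?_) hn
  simpa [DiCtx.fill] using hu

/-! ### Triviality of the compositions -/

variable [IsDialgebra k D] (hI₀ : Submodule.span k (x '' I₀) = diffIdeal k D)

include hI₀

/-- Under `y ⊣`, the product `p ⊢ q` may be replaced by `p ⊣ q`, which brings in the right normed
`⊣`-relations. For `p, q` in `X` the tails then differ by an element coming from `A`, killed by `y
⊣`. -/
theorem VdRel.trivialLeft (h : VdRel x I₀ p q t) (y : WithTop I) :
    TrivialLeft (barRel x I₀) (gen k y ⊣ᵈ (gen k p ⊢ᵈ gen k q - t)) := by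
  have hdeg : 3 ≤ deg (gen k y ⊣ᵈ (gen k p ⊢ᵈ gen k q - t)) := by
    rw [← app_rgt_singleton, gen_vd_gen]
    exact length_fill_le_deg_app (DiCtx.rgt [] y [] []) (u := ⟨[p], q, []⟩) le_rfl h.mem_letters
  change _ ∈ rightNormedSpan _ _
  -- Only `3 ≤ n` matters; freezing the degree keeps the rewriting below from touching the bound.
  generalize deg (gen k y ⊣ᵈ (gen k p ⊢ᵈ gen k q - t)) = n at hdeg
  have hle := dvSpan_le_rightNormedSpan (x := x) (I₀ := I₀) (n := n) (by omega)
  rw [dv_sub_right k, IsDialgebra.dv_vd k]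
  rcases h with ⟨i, j, rfl, rfl, rfl⟩ | ⟨rfl, rfl⟩ | ⟨i, hi, rfl, rfl, rfl⟩
  · have h₁ : DvRel x I₀ i j _ := Or.inl ⟨i, j, rfl, rfl, rfl⟩
    have h₂ := gen_dv_barLift_mem hI₀ (dv_sub_vd_mem_diffIdeal (x i) (x j)) y
    rw [map_sub, dv_sub_right k] at h₂
    have h₃ := add_mem (h₁.gen_dv_mem y hdeg) (hle h₂)
    rwa [dv_sub_right k, sub_add_sub_cancel] at h₃
  -- For `p = e` the composition is exactly `(y ⊣ e - y) ⊣ q`.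
  · have h₁ : DvRel x I₀ y ⊤ _ := Or.inr (Or.inl ⟨rfl, rfl⟩)
    have h₂ := h₁.dv_gen_mem q hdeg
    rwa [dv_sub_left k, IsDialgebra.dv_assoc k] at h₂
  -- For `x_i ⊢ e` with `x_i` in `A`: `y ⊣ (x_i ⊣ e)` is `y ⊣ (x_i ⊣ e - x_i)` plus `y ⊣ x_i`, and
  -- the latter is a combination of `⊣`-relations.
  · have h₁ : DvRel x I₀ i ⊤ _ := Or.inr (Or.inl ⟨rfl, rfl⟩)
    have h₂ := gen_dv_barLift_mem hI₀ (basis_mem_diffIdeal hI₀ hi) y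
    rw [barLift_basis] at h₂
    have h₃ := add_mem (h₁.gen_dv_mem y hdeg) (hle h₂)
    rw [dv_sub_right k, sub_add_cancel] at h₃
    rwa [dv_zero, sub_zero]

theorem DvRel.trivialRight (h : DvRel x I₀ p q t) (y : WithTop I) :
    TrivialRight (barRel x I₀) ((gen k p ⊣ᵈ gen k q - t) ⊢ᵈ gen k y) := by
  have hdeg : 3 ≤ deg ((gen k p ⊣ᵈ gen k q - t) ⊢ᵈ gen k y) := by
    rw [← app_lft_singleton, gen_dv_gen]
    exact length_fill_le_deg_app (DiCtx.lft [] [] y []) (u := ⟨[], p, [q]⟩) le_rfl h.mem_letters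
  change _ ∈ leftNormedSpan _ _
  generalize deg ((gen k p ⊣ᵈ gen k q - t) ⊢ᵈ gen k y) = n at hdeg
  have hle := vdSpan_le_leftNormedSpan (x := x) (I₀ := I₀) (n := n) (by omega)
  rw [vd_sub_left k, IsDialgebra.vd_dv k]
  rcases h with ⟨i, j, rfl, rfl, rfl⟩ | ⟨rfl, rfl⟩ | ⟨i, hi, rfl, rfl, rfl⟩
  · have h₁ : VdRel x I₀ i j _ := Or.inl ⟨i, j, rfl, rfl, rfl⟩
    have h₂ := barLift_vd_gen_mem hI₀ (dv_sub_vd_mem_diffIdeal (x i) (x j)) y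
    rw [map_sub, vd_sub_left k] at h₂
    have h₃ := sub_mem (h₁.vd_gen_mem y hdeg) (hle h₂)
    rwa [vd_sub_left k, sub_sub_sub_cancel_right] at h₃
  · have h₁ : VdRel x I₀ ⊤ y _ := Or.inr (Or.inl ⟨rfl, rfl⟩)
    have h₂ := h₁.gen_vd_mem p hdeg
    rwa [vd_sub_right k, ← IsDialgebra.vd_assoc k] at h₂
  · have h₁ : VdRel x I₀ ⊤ i _ := Or.inr (Or.inl ⟨rfl, rfl⟩)
    have h₂ := barLift_vd_gen_mem hI₀ (basis_mem_diffIdeal hI₀ hi) y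
    rw [barLift_basis] at h₂
    have h₃ := add_mem (h₁.vd_gen_mem y hdeg) (hle h₂)
    rw [vd_sub_left k, sub_add_cancel] at h₃
    rwa [zero_vd, sub_zero]

theorem trivialAt_intersection {f g : FreeDi k (WithTop I)} (hf : f ∈ barRel x I₀)
    (hg : g ∈ barRel x I₀) {u v w : Diword (WithTop I)} (hu : IsLeading f u) (hv : IsLeading g v)
    {C₁ C₂ : DiCtx (WithTop I)} (hC₁ : C₁.pre = []) (hC₂ : C₂.post = [])
    (hn₁ : C₁.IsNormal f) (hn₂ : C₂.IsNormal g) (hw₁ : C₁.fill u = w) (hw₂ : C₂.fill v = w)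
    (hw : w.length < u.length + v.length) : TrivialAt (barRel x I₀) w C₁ f C₂ g := by
  have hul := length_of_isLeading_of_mem_barRel hf hu
  have hvl := length_of_isLeading_of_mem_barRel hg hv
  have h₁ : w.length = 2 + C₁.post.length := by
    rw [← hw₁, DiCtx.length_fill, hC₁, hul, List.length_nil, zero_add]
  have h₂ : w.length = C₂.pre.length + 2 := by
    rw [← hw₂, DiCtx.length_fill, hC₂, hvl, List.length_nil, add_zero]
  -- Two words of length two overlap in both letters, forcing the same relation, or in exactly one.
  rcases Nat.eq_zero_or_pos C₁.post.length with h0 | hpos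
  · obtain rfl := DiCtx.eq_mid_of_pre_post_nil hC₁ (List.length_eq_zero_iff.1 h0)
    obtain rfl := DiCtx.eq_mid_of_pre_post_nil (C := C₂) (List.length_eq_zero_iff.1 (by omega)) hC₂
    have huv : u = v := by
      simpa [DiCtx.fill, Diword.ext_iff] using hw₁.trans hw₂.symm
    subst huv
    rw [eq_of_isLeading_of_mem_barRel hf hg hu hv]
    exact trivialAt_of_eq rfl
  have hw' : 2 < w.length := by omega
  obtain ⟨r, hr⟩ := DiCtx.eq_of_pre_nil hC₁ (by omega)
  obtain ⟨z, hz⟩ := DiCtx.eq_of_post_nil hC₂ (by omega)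
  have e := hw₁.trans hw₂.symm
  -- Of the sixteen combinations of relation types and contexts, comparing the positions of the
  -- centers leaves five; normality of the contexts rules out two of these.
  rcases exists_rel_of_mem_barRel hf with ⟨p, q, t, h, rfl⟩ | ⟨p, q, t, h, rfl⟩ <;>
  rcases exists_rel_of_mem_barRel hg with ⟨p', q', t', h', rfl⟩ | ⟨p', q', t', h', rfl⟩ <;>
  rcases hr with rfl | rfl <;> rcases hz with rfl | rfl <;>
  obtain rfl := h.eq_of_isLeading hu <;> obtain rfl := h'.eq_of_isLeading hv <;>
  simp only [DiCtx.fill, Diword.word, Diword.mk.injEq, List.cons.injEq, List.cons_append,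
    List.nil_append, List.append_nil, and_true, true_and, reduceCtorEq, and_false] at e
  · obtain ⟨⟨rfl, rfl⟩, rfl⟩ := e
    refine TrivialAt.of_mem_vdSpan hw' (Or.inl h.not_rightNormed) ?_
    rw [app_lft_singleton, app_mid_singleton_nil]
    exact h.overlap_mem hI₀ h'
  · obtain ⟨rfl, rfl, rfl⟩ := e
    refine TrivialAt.of_mem_sup hw' h.not_rightNormed h'.not_leftNormed ?_
    rw [app_mid_nil_singleton, app_mid_singleton_nil]
    exact h.overlap_dvRel_mem h'
  · exact absurd hn₂ h'.not_rightNormed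
  · exact absurd hn₁ h.not_leftNormed
  · obtain ⟨rfl, rfl, rfl⟩ := e
    refine TrivialAt.of_mem_dvSpan hw' (Or.inl h.not_leftNormed) ?_
    rw [app_mid_nil_singleton, app_rgt_singleton]
    exact h.overlap_mem hI₀ h'

theorem isGSBasis_barRel : IsGSBasis (barRel x I₀) where
  monic _ hs := isMonic_of_mem_barRel hs
  left_mul f hf hn y := by
    rcases exists_rel_of_mem_barRel hf with ⟨p, q, t, h, rfl⟩ | ⟨p, q, t, h, rfl⟩
    · exact h.trivialLeft hI₀ y
    · exact absurd h.rightNormed hn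
  right_mul f hf hn y := by
    rcases exists_rel_of_mem_barRel hf with ⟨p, q, t, h, rfl⟩ | ⟨p, q, t, h, rfl⟩
    · exact absurd h.leftNormed hn
    · exact h.trivialRight hI₀ y
  inclusion f hf g hg u v hu hv C _ hC := by
    -- All leading diwords have length two, so an inclusion has empty context and compares a
    -- relation with itself.
    have h := congrArg Diword.length hC
    rw [DiCtx.length_fill, length_of_isLeading_of_mem_barRel hf hu,
      length_of_isLeading_of_mem_barRel hg hv] at h
    obtain rfl := DiCtx.eq_mid_of_pre_post_nil (C := C) (List.length_eq_zero_iff.1 (by omega))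
      (List.length_eq_zero_iff.1 (by omega))
    have huv : v = u := by
      simpa [DiCtx.fill, Diword.ext_iff] using hC
    subst huv
    rw [eq_of_isLeading_of_mem_barRel hf hg hu hv]
    exact trivialAt_of_eq rfl
  intersection f hf g hg u v w hu hv C₁ C₂ h₁ h₂ hn₁ hn₂ hw₁ hw₂ hw :=
    trivialAt_intersection hI₀ hf hg hu hv h₁ h₂ hn₁ hn₂ hw₁ hw₂ hw

end Compositions

/-! ### The quotient by the relations -/

section Quotient

open FreeDi

variable {k D I : Type*} [Field k] [AddCommGroup D] [Module k D] [DiMul D]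
variable {x : Module.Basis I k D} {I₀ : Set I}

theorem FreeDi.single_eq_dvWord {X : Type*} (u : Diword X) (c : k) :
    (Finsupp.single u c : FreeDi k X) =
      c • DiCtx.dvWord (DiCtx.vdWord u.left (gen k u.center)) u.right := by
  rw [DiCtx.vdWord_eq, DiCtx.dvWord_eq, gen, Finsupp.mapDomain_single, Finsupp.mapDomain_single,
    Finsupp.smul_single, smul_eq_mul, mul_one]
  simp

/-- A submodule containing the letters and stable under the products `y ⊢ f` and `f ⊣ y` by
letters is everything. -/
theorem FreeDi.mem_of_letters {X : Type*} (N : Submodule k (FreeDi k X))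
    (hgen : ∀ y, gen k y ∈ N) (hvd : ∀ y, ∀ f ∈ N, gen k y ⊢ᵈ f ∈ N)
    (hdv : ∀ y, ∀ f ∈ N, f ⊣ᵈ gen k y ∈ N) (f : FreeDi k X) : f ∈ N := by
  have h₁ : ∀ (l : List X) (f : FreeDi k X), f ∈ N → DiCtx.vdWord l f ∈ N := by
    intro l f hf
    induction l with
    | nil => exact hf
    | cons y l ih => exact hvd y _ ih
  have h₂ : ∀ (r : List X) (f : FreeDi k X), f ∈ N → DiCtx.dvWord f r ∈ N := by
    intro r
    induction r with
    | nil => exact fun f hf => hf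
    | cons y r ih => exact fun f hf => ih _ (hdv y _ hf)
  induction f using Finsupp.induction_linear with
  | zero => exact zero_mem N
  | add f g hf hg => exact add_mem hf hg
  | single u c =>
    rw [single_eq_dvWord]
    exact N.smul_mem c (h₂ _ _ (h₁ _ _ (hgen _)))

theorem isBarUnit_mkQ_gen_top : IsBarUnit ((diIdeal k (barRel x I₀)).mkQ
    (gen k (⊤ : WithTop I)) : BarExt x I₀) := by
  have hJ := isDiIdeal_diIdeal k (barRel x I₀)
  intro m
  obtain ⟨f, rfl⟩ := Submodule.mkQ_surjective _ m
  rw [← mkQ_vd, ← mkQ_dv, Submodule.mkQ_apply, Submodule.mkQ_apply, Submodule.mkQ_apply,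
    Submodule.Quotient.eq, Submodule.Quotient.eq]
  constructor
  -- The relations give `e ⊢ y = y` only for letters. It propagates by `e ⊢ (y ⊢ f) = (e ⊢ y) ⊢ f`
  -- and `e ⊢ (f ⊣ y) = (e ⊢ f) ⊣ y`; only the second needs the induction hypothesis.
  · refine mem_of_letters ((diIdeal k (barRel x I₀)).comap
      (vdMap k _ (gen k (⊤ : WithTop I)) - LinearMap.id)) ?_ ?_ ?_ f
    · exact fun y => vdSpan_le_diIdeal (top_vd_sub_mem (gen_mem_letters y))
    · intro y f _
      have h := (hJ f _ (vdSpan_le_diIdeal (top_vd_sub_mem (gen_mem_letters y)))).2.1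
      rwa [vd_sub_left k, IsDialgebra.vd_assoc k] at h
    · intro y f hf
      have h := (hJ (gen k y) _ hf).2.2.2
      rwa [LinearMap.sub_apply, LinearMap.id_apply, vdMap_apply, dv_sub_left k,
        ← IsDialgebra.vd_dv_assoc k] at h
  · refine mem_of_letters ((diIdeal k (barRel x I₀)).comap
      ((dvMap k _).flip (gen k (⊤ : WithTop I)) - LinearMap.id)) ?_ ?_ ?_ f
    · exact fun y => dvSpan_le_diIdeal (dv_top_sub_mem (gen_mem_letters y))
    · intro y f hf
      have h := (hJ (gen k y) _ hf).1
      rwa [LinearMap.sub_apply, LinearMap.id_apply, LinearMap.flip_apply, dvMap_apply,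
        vd_sub_right k, IsDialgebra.vd_dv_assoc k] at h
    · intro y f _
      have h := (hJ f _ (dvSpan_le_diIdeal (dv_top_sub_mem (gen_mem_letters y)))).2.2.1
      rwa [dv_sub_right k, ← IsDialgebra.dv_assoc k] at h

variable [IsDialgebra k D]

theorem isDialgebraHom_mkQ_comp_barLift :
    IsDialgebraHom ((diIdeal k (barRel x I₀)).mkQ ∘ₗ barLift x : D →ₗ[k] BarExt x I₀) := by
  intro a b
  simp only [LinearMap.comp_apply, ← mkQ_vd, ← mkQ_dv]
  constructor
  · rw [eq_comm, ← sub_eq_zero, ← map_sub]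
    exact (Submodule.Quotient.mk_eq_zero _).2 (vdSpan_le_diIdeal (barLift_vd_sub_mem a b))
  · rw [eq_comm, ← sub_eq_zero, ← map_sub]
    exact (Submodule.Quotient.mk_eq_zero _).2 (dvSpan_le_diIdeal (barLift_dv_sub_mem a b))

variable (x) in
/-- The homomorphism from `D(X ∪ {e})` to the hull of `D`, sending `e` to the bar unit. -/
noncomputable def toBarHull : FreeDi k (WithTop I) →ₗ[k] BarHull k D :=
  lift k (WithTop.recTopCoe (BarHull.unit k D) fun i => BarHull.incl k D (x i))

theorem toBarHull_barLift (d : D) : toBarHull x (barLift x d) = BarHull.incl k D d := by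
  rw [← LinearMap.comp_apply]
  congr 1
  refine x.ext fun i => ?_
  rw [LinearMap.comp_apply, barLift_basis, toBarHull, lift_gen]
  rfl

/-- The hull satisfies every relation. The multiplication table and the unit relations hold by
construction; only `x₀ ⊢ e` and `e ⊣ x₀` depend on `x₀` lying in `A`. -/
theorem diIdeal_barRel_le_ker (hI₀ : Submodule.span k (x '' I₀) = diffIdeal k D) :
    diIdeal k (barRel x I₀) ≤ LinearMap.ker (toBarHull x) := by
  have hom : IsDialgebraHom (toBarHull x) := isDialgebraHom_lift k _
  have hcoe (i : I) : toBarHull x (gen k (i : WithTop I)) = BarHull.incl k D (x i) :=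
    lift_gen k _ _
  have htop : toBarHull x (gen k (⊤ : WithTop I)) = BarHull.unit k D := lift_gen k _ _
  refine diIdeal_le (isDiIdeal_ker hom) ?_
  rintro s (((((⟨i, j, rfl⟩ | ⟨i, j, rfl⟩) | ⟨y, rfl⟩) | ⟨y, rfl⟩) | ⟨i, hi, rfl⟩) | ⟨i, hi, rfl⟩) <;>
  simp only [SetLike.mem_coe, LinearMap.mem_ker, map_sub, (hom _ _).1, (hom _ _).2, htop, hcoe,
    toBarHull_barLift, (BarHull.isDialgebraHom_incl _ _).1, (BarHull.isDialgebraHom_incl _ _).2,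
    (BarHull.isBarUnit_unit _).1, (BarHull.isBarUnit_unit _).2, sub_self]
  · exact BarHull.incl_vd_unit (basis_mem_diffIdeal hI₀ hi)
  · exact BarHull.unit_dv_incl (basis_mem_diffIdeal hI₀ hi)

/-- An element of `D` that dies in the quotient dies in the hull as well, where `D` embeds. -/
theorem mkQ_comp_barLift_injective (hI₀ : Submodule.span k (x '' I₀) = diffIdeal k D) :
    Function.Injective ((diIdeal k (barRel x I₀)).mkQ ∘ₗ barLift x : D →ₗ[k] BarExt x I₀) := by
  rw [← LinearMap.ker_eq_bot, LinearMap.ker_eq_bot']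
  intro d hd
  have h := diIdeal_barRel_le_ker hI₀ ((Submodule.Quotient.mk_eq_zero _).1 hd)
  rw [LinearMap.mem_ker, toBarHull_barLift] at h
  exact BarHull.incl_injective (h.trans (map_zero _).symm)

end Quotient

theorem mainTheorem4 {k : Type u} {D : Type v} [Field k] [AddCommGroup D] [Module k D]
    [DiMul D] [IsDialgebra k D] :
    -- `D` has a bar unit extension
    (∃ (E : Type (max u v)) (_ : AddCommGroup E) (_ : Module k E) (_ : DiMul E)
        (_ : IsDialgebra k E) (φ : D →ₗ[k] E) (e : E),
        IsDialgebraHom φ ∧ Function.Injective φ ∧ IsBarUnit e) ∧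
    -- a well-ordered basis of `D` of the required kind exists
    (∃ (I : Type v) (_ : LinearOrder I) (_ : WellFoundedLT I) (x : Module.Basis I k D)
        (I₀ : Set I), Submodule.span k (x '' I₀) = diffIdeal k D) ∧
    -- for each such basis the explicit construction works
    (∀ (I : Type w) [LinearOrder I] [WellFoundedLT I] (x : Module.Basis I k D) (I₀ : Set I),
        Submodule.span k (x '' I₀) = diffIdeal k D →
        FreeDi.IsGSBasis (barRel x I₀) ∧
        IsBarUnit ((diIdeal k (barRel x I₀)).mkQ (FreeDi.gen k (⊤ : WithTop I)) :
          BarExt x I₀) ∧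
        IsDialgebraHom ((diIdeal k (barRel x I₀)).mkQ ∘ₗ barLift x : D →ₗ[k] BarExt x I₀) ∧
        Function.Injective ((diIdeal k (barRel x I₀)).mkQ ∘ₗ barLift x : D →ₗ[k] BarExt x I₀)) := by
  refine ⟨⟨BarHull k D, inferInstance, inferInstance, inferInstance, inferInstance,
    BarHull.incl k D, BarHull.unit k D, BarHull.isDialgebraHom_incl, BarHull.incl_injective,
    BarHull.isBarUnit_unit⟩, exists_wellOrdered_basis_span_eq _, ?_⟩
  intro I _ _ x I₀ hI₀
  exact ⟨isGSBasis_barRel hI₀, isBarUnit_mkQ_gen_top, isDialgebraHom_mkQ_comp_barLift,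
    mkQ_comp_barLift_injective hI₀⟩
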